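/- **Setting.** A concurrent game $G$ has finite sets $S$ of states and $A$ of moves, non-empty sets $\Gamma_1(s),\Gamma_2(s)\subseteq A$ of available moves for each state $s$, a transition distribution $\delta(s,a_1,a_2)$ on $S$, and a reward $r(s,a_1,a_2)\in\{0,1\}$. In each round both players choose moves simultaneously and independently. Let $m=\max_{s}\max\{|\Gamma_1(s)|,|\Gamma_2(s)|\}$. A strategy of player $i$ assigns to each finite history $x\in(S\times A\times A)^*$ and current state $s$ a distribution on $\Gamma_i(s)$. It is *stationary* if it depends only on $s$, and *Markov* if it depends only on $|x|$ and $s$. The *patience* of a stationary strategy is the inverse of the smallest non-zero probability that it assigns to a move. A strategy may be presented by a set of memory states with an initial element, a next-move function and a deterministic update function; it is *finite-memory* if it has such a presentation with a finite memory set. The *time-dependent memory* of a presentation is $\Theta(T)$, the number of memory states it uses in the first $T$ rounds, i.e. after histories of fewer than $T$ completed rounds. $\mathsf{LimInfAvg}(\lambda)$ and $\mathsf{LimSupAvg}(\lambda)$ are the sets of plays with $\liminf$, resp. $\limsup$, of the average rewards at least $\lambda$; $\overline{\mathsf{LimInfAvg}}(\lambda)$ and $\overline{\mathsf{LimSupAvg}}(\lambda)$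 are their complements. A strategy $\sigma_1$ is *positive winning* from $s$ for $\Phi$ if $\Pr_s^{\sigma_1,\sigma_2}(\Phi)>0$ for all $\sigma_2$, and $\mathsf{Positive}_1(\Phi)$ is the set of states from which player 1 has such a strategy; a strategy $\sigma_2$ is *almost-sure winning* from $s$ for $\Phi$ if $\Pr_s^{\sigma_1,\sigma_2}(\Phi)=1$ for all $\sigma_1$. **Theorem (strategy complexity for positive winning).** 1. *Player 1, sufficiency.* In every concurrent game there is one Markov strategy $\sigma_1$, with a presentation satisfying $\Theta(T)\le T$ for all $T>0$, that is positive winning * for $\mathsf{LimInfAvg}(1)$ from every state of $\mathsf{Positive}_1(\mathsf{LimInfAvg}(1))$; * for $\mathsf{LimInfAvg}(1-\epsilon)$, for all $\epsilon>0$, from every state of $\bigcap_{\epsilon>0}\mathsf{Positive}_1(\mathsf{LimInfAvg}(1-\epsilon))$; * moreover, for some $\epsilon_0>0$ depending on the game and all $0<\epsilon<\epsilon_0$, for $\mathsf{LimInfAvg}(1-\epsilon)$ from every state of $\mathsf{Positive}_1(\mathsf{LimInfAvg}(1-\epsilon))$; and likewise with $\mathsf{LimSupAvg}$ in place of $\mathsf{LimInfAvg}$.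 2. *Player 1, necessity.* Let $\bar G$ be the game with states $v,v^0,v^1$, where $v^0,v^1$ are absorbing with a single move for each player and rewards $0$ and $1$, and where at $v$ player 1 has moves $a_1,a_2$ and player 2 has moves $b_1,b_2$: $(a_1,b_1)$ leads to $v^1$ with reward $0$, $(a_2,b_2)$ leads to $v$ with reward $1$, and $(a_1,b_2)$, $(a_2,b_1)$ lead to $v^0$ with reward $0$. Then $v\in\mathsf{Positive}_1(\mathsf{LimInfAvg}(1))$, and for all $0\le\epsilon<1$, no strategy of player 1 that is positive winning from $v$ for $\mathsf{LimInfAvg}(1-\epsilon)$ or for $\mathsf{LimSupAvg}(1-\epsilon)$ is finite-memory, and every presentation of such a strategy satisfies $\Theta(T)\ge T$ for all $T>0$. 3. *Player 2, sufficiency.* In every concurrent game there are a constant $c>0$ and a stationary strategy $\sigma_2$ of patience at most $m$ that, from every state $s\notin\mathsf{Positive}_1(\mathsf{LimInfAvg}(1))$, is almost-sure winning for $\overline{\mathsf{LimInfAvg}}(1)$, $\overline{\mathsf{LimInfAvg}}(1-c)$, $\overline{\mathsf{LimSupAvg}}(1)$ and $\overline{\mathsf{LimSupAvg}}(1-c)$.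 4. *Player 2, necessity.* For $m>0$ let $\underline{G^m}$ be the game with a single state $v$, moves $a_1,\dots,a_m$ of player 1 and $b_1,\dots,b_m$ of player 2, and reward $0$ for $(a_i,b_i)$ and $1$ for $(a_i,b_j)$ with $i\ne j$. Its maximal number of moves is $m$, player 2 has an almost-sure winning strategy from $v$ for $\overline{\mathsf{LimInfAvg}}(1)$, and for every $c\ge 0$ no stationary strategy of player 2 with patience less than $m$ is almost-sure winning from $v$ for $\overline{\mathsf{LimInfAvg}}(1-c)$ or for $\overline{\mathsf{LimSupAvg}}(1-c)$. -/

import Mathlib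

open MeasureTheory ProbabilityTheory Filter
open scoped ENNReal

noncomputable section

/-- One round of a play: the current state and the moves chosen by player 1 and player 2. -/
structure Step (S A : Type*) where
  st : S
  act₁ : A
  act₂ : A

namespace Step

variable {S A : Type*}

instance [Finite S] [Finite A] : Finite (Step S A) :=
  Finite.of_injective (fun x : Step S A => (x.st, x.act₁, x.act₂)) (by
    rintro ⟨s, a, b⟩ ⟨t, c, d⟩ h
    simpa using h)

instance : MeasurableSpace (Step S A) := ⊤

instance : DiscreteMeasurableSpace (Step S A) := ⟨fun _ => trivial⟩

end Step

/-- A concurrent stochastic game structure on finite sets `S` of states and `A` of moves, with a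
boolean reward function. `moves₁ s`, `moves₂ s` are the non-empty sets of moves available to the two
players at `s`. The values of `trans` and `reward` at unavailable moves play no role. -/
structure ConcurrentGame (S A : Type*) where
  moves₁ : S → Finset A
  moves₂ : S → Finset A
  moves₁_nonempty : ∀ s, (moves₁ s).Nonempty
  moves₂_nonempty : ∀ s, (moves₂ s).Nonempty
  trans : S → A → A → PMF S
  reward : S → A → A → Bool

/-- A strategy of a player with available moves `Γ`: it maps a finite history (the list of
completed rounds, oldest first) and the current state to a distribution on available moves. -/
structure Strategy {S A : Type*} (Γ : S → Finset A) where
  move : List (Step S A) → S → PMF A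
  support_subset : ∀ h s, (move h s).support ⊆ (Γ s : Set A)

namespace Strategy

variable {S A : Type*} {Γ : S → Finset A}

/-- The strategy depends only on the current state. -/
def IsStationary (σ : Strategy Γ) : Prop :=
  ∀ h h' s, σ.move h s = σ.move h' s

/-- The strategy depends only on the length of the history and the current state. -/
def IsMarkov (σ : Strategy Γ) : Prop :=
  ∀ h h' : List (Step S A), h.length = h'.length → ∀ s, σ.move h s = σ.move h' s

/-- The inverse of the smallest non-zero probability that the strategy assigns to a move
(used for stationary strategies, where the history is irrelevant). -/
def patience (σ : Strategy Γ) : ℝ≥0∞ :=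
  ⨆ (h : List (Step S A)) (s : S) (a ∈ (σ.move h s).support), (σ.move h s a)⁻¹

end Strategy

/-- A strategy presented with a set `Mem` of memory states: an initial memory state, a next-move
function and a deterministic memory-update function. -/
structure MemoryStrategy {S A : Type*} (Γ : S → Finset A) (Mem : Type*) where
  init : Mem
  next : S → Mem → PMF A
  update : Step S A → Mem → Mem
  support_subset : ∀ s m, (next s m).support ⊆ (Γ s : Set A)

namespace MemoryStrategy

variable {S A : Type*} {Γ : S → Finset A} {Mem : Type*}

/-- The memory state reached after a history. -/
def memoryAfter (M : MemoryStrategy Γ Mem) (h : List (Step S A)) : Mem :=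
  h.foldl (fun m x => M.update x m) M.init

/-- The strategy (as a function of histories) that is played. -/
def toStrategy (M : MemoryStrategy Γ Mem) : Strategy Γ where
  move h s := M.next s (M.memoryAfter h)
  support_subset h s := M.support_subset s (M.memoryAfter h)

/-- The time-dependent memory: the number of memory states that are used in the first `T` rounds.
The history before round `k` consists of `k - 1` completed rounds. -/
def timeMemory (M : MemoryStrategy Γ Mem) (T : ℕ) : ℕ∞ :=
  Set.encard {m : Mem | ∃ h : List (Step S A), h.length < T ∧ M.memoryAfter h = m}

end MemoryStrategy

namespace Strategy

variable {S A : Type*} {Γ : S → Finset A}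

/-- The strategy can be played with a finite set of memory states. -/
def IsFiniteMemory (σ : Strategy Γ) : Prop :=
  ∃ (Mem : Type) (_ : Finite Mem) (M : MemoryStrategy Γ Mem), M.toStrategy = σ

/-- The strategy can be played with time-dependent memory at most `T`, for all `T > 0`. -/
def HasTimeMemoryAtMostT (σ : Strategy Γ) : Prop :=
  ∃ (Mem : Type) (M : MemoryStrategy Γ Mem), M.toStrategy = σ ∧
    ∀ T : ℕ, 0 < T → M.timeMemory T ≤ T

end Strategy

namespace ConcurrentGame

variable {S A : Type*}

/-- The maximal number of moves available to a player at a state. -/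
def maxMoves [Fintype S] (G : ConcurrentGame S A) : ℕ :=
  Finset.univ.sup fun s => max (G.moves₁ s).card (G.moves₂ s).card

/-- The law of the next round when the history is `h` and the current state is `s`: the players
choose their moves independently. -/
def roundLaw (G : ConcurrentGame S A) (σ₁ : Strategy G.moves₁) (σ₂ : Strategy G.moves₂)
    (h : List (Step S A)) (s : S) : PMF (Step S A) :=
  (σ₁.move h s).bind fun a => (σ₂.move h s).bind fun b => PMF.pure ⟨s, a, b⟩

/-- The list of the first `n + 1` rounds. -/
def historyList {n : ℕ} (x : (i : Finset.Iic n) → Step S A) : List (Step S A) :=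
  List.ofFn fun i : Fin (n + 1) => x ⟨i, Finset.mem_Iic.2 (Nat.lt_succ_iff.1 i.2)⟩

/-- The law of round `n + 1` given the rounds `0, …, n`. -/
def nextRound (G : ConcurrentGame S A) (σ₁ : Strategy G.moves₁) (σ₂ : Strategy G.moves₂)
    (n : ℕ) (x : (i : Finset.Iic n) → Step S A) : PMF (Step S A) :=
  let last := x ⟨n, Finset.mem_Iic.2 le_rfl⟩
  (G.trans last.st last.act₁ last.act₂).bind fun t => G.roundLaw σ₁ σ₂ (historyList x) t

section PlayMeasure

variable [Finite S] [Finite A]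

/-- `nextRound` as a Markov kernel. -/
def roundKernel (G : ConcurrentGame S A) (σ₁ : Strategy G.moves₁) (σ₂ : Strategy G.moves₂)
    (n : ℕ) : Kernel ((i : Finset.Iic n) → Step S A) (Step S A) :=
  Kernel.ofFunOfCountable fun x => (G.nextRound σ₁ σ₂ n x).toMeasure

instance (G : ConcurrentGame S A) (σ₁ : Strategy G.moves₁) (σ₂ : Strategy G.moves₂) (n : ℕ) :
    IsMarkovKernel (G.roundKernel σ₁ σ₂ n) :=
  ⟨fun x => inferInstanceAs (IsProbabilityMeasure (G.nextRound σ₁ σ₂ n x).toMeasure)⟩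

/-- The probability measure on plays induced by the two strategies from the initial state `s`. -/
def playMeasure (G : ConcurrentGame S A) (σ₁ : Strategy G.moves₁) (σ₂ : Strategy G.moves₂)
    (s : S) : Measure (ℕ → Step S A) :=
  Kernel.trajMeasure (X := fun _ => Step S A) (G.roundLaw σ₁ σ₂ [] s).toMeasure
    (G.roundKernel σ₁ σ₂)

end PlayMeasure

/-- The average reward of the first `n` rounds of a play. -/
def avgReward (G : ConcurrentGame S A) (π : ℕ → Step S A) (n : ℕ) : ℝ :=
  (1 / (n : ℝ)) * ∑ i ∈ Finset.range n,
    if G.reward (π i).st (π i).act₁ (π i).act₂ then (1 : ℝ) else 0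

/-- The objective `LimInfAvg(l)`: the limit-inferior average is at least `l`. -/
def LimInfAvg (G : ConcurrentGame S A) (l : ℝ) : Set (ℕ → Step S A) :=
  {π | l ≤ liminf (G.avgReward π) atTop}

/-- The objective `LimSupAvg(l)`: the limit-superior average is at least `l`. -/
def LimSupAvg (G : ConcurrentGame S A) (l : ℝ) : Set (ℕ → Step S A) :=
  {π | l ≤ limsup (G.avgReward π) atTop}

/-- The complementary objective: the limit-inferior average is less than `l`. -/
def CoLimInfAvg (G : ConcurrentGame S A) (l : ℝ) : Set (ℕ → Step S A) :=
  {π | liminf (G.avgReward π) atTop < l}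

/-- The complementary objective: the limit-superior average is less than `l`. -/
def CoLimSupAvg (G : ConcurrentGame S A) (l : ℝ) : Set (ℕ → Step S A) :=
  {π | limsup (G.avgReward π) atTop < l}

section Winning

variable [Finite S] [Finite A]

/-- `σ₁` is a positive winning strategy of player 1 from `s` for the objective `Φ`. -/
def PositiveWinning₁ (G : ConcurrentGame S A) (σ₁ : Strategy G.moves₁) (s : S)
    (Φ : Set (ℕ → Step S A)) : Prop :=
  ∀ σ₂ : Strategy G.moves₂, 0 < G.playMeasure σ₁ σ₂ s Φ

/-- `σ₂` is an almost-sure winning strategy of player 2 from `s` for the objective `Φ`. -/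
def AlmostSureWinning₂ (G : ConcurrentGame S A) (σ₂ : Strategy G.moves₂) (s : S)
    (Φ : Set (ℕ → Step S A)) : Prop :=
  ∀ σ₁ : Strategy G.moves₁, G.playMeasure σ₁ σ₂ s Φ = 1

/-- The positive winning set of player 1. -/
def Positive₁ (G : ConcurrentGame S A) (Φ : Set (ℕ → Step S A)) : Set S :=
  {s | ∃ σ₁ : Strategy G.moves₁, G.PositiveWinning₁ σ₁ s Φ}

/-- The almost-sure winning set of player 2. -/
def Almost₂ (G : ConcurrentGame S A) (Φ : Set (ℕ → Step S A)) : Set S :=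
  {s | ∃ σ₂ : Strategy G.moves₂, G.AlmostSureWinning₂ σ₂ s Φ}

end Winning

end ConcurrentGame

/-- The states of the game `barG`. -/
inductive BarState
  | v0 | v1 | v
  deriving DecidableEq

instance : Fintype BarState :=
  ⟨{.v0, .v1, .v}, fun s => by cases s <;> simp⟩

/-- The moves of the game `barG`; `aAbs i`, `bAbs i` are the only moves at the absorbing state
`v i`. -/
inductive BarMove
  | aAbs0 | aAbs1 | a1 | a2 | bAbs0 | bAbs1 | b1 | b2
  deriving DecidableEq

instance : Fintype BarMove :=
  ⟨{.aAbs0, .aAbs1, .a1, .a2, .bAbs0, .bAbs1, .b1, .b2}, fun a => by cases a <;> simp⟩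

/-- The repeated game with absorbing states `v0` (reward 0) and `v1` (reward 1). At `v`, the moves
`a1, b1` lead to `v1` with reward 0, the moves `a2, b2` lead back to `v` with reward 1, and the two
other pairs of moves lead to `v0` with reward 0. -/
def barG : ConcurrentGame BarState BarMove where
  moves₁
    | .v0 => {.aAbs0}
    | .v1 => {.aAbs1}
    | .v => {.a1, .a2}
  moves₂
    | .v0 => {.bAbs0}
    | .v1 => {.bAbs1}
    | .v => {.b1, .b2}
  moves₁_nonempty s := by cases s <;> simp
  moves₂_nonempty s := by cases s <;> simp
  trans
    | .v0, _, _ => PMF.pure .v0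
    | .v1, _, _ => PMF.pure .v1
    | .v, .a1, .b1 => PMF.pure .v1
    | .v, .a2, .b2 => PMF.pure .v
    | .v, _, _ => PMF.pure .v0
  reward
    | .v1, _, _ => true
    | .v, .a2, .b2 => true
    | _, _, _ => false

/-- The one-state game in which each player has `m` moves, `Sum.inl i` for player 1 and `Sum.inr i`
for player 2, and the reward is 0 exactly when the indices agree. -/
def underG (m : ℕ) (hm : 0 < m) : ConcurrentGame Unit (Fin m ⊕ Fin m) where
  moves₁ _ := Finset.univ.map Function.Embedding.inl
  moves₂ _ := Finset.univ.map Function.Embedding.inr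
  moves₁_nonempty _ := ⟨Sum.inl ⟨0, hm⟩, by simp⟩
  moves₂_nonempty _ := ⟨Sum.inr ⟨0, hm⟩, by simp⟩
  trans _ _ _ := PMF.pure ()
  reward
    | _, .inl i, .inr j => decide (i ≠ j)
    | _, _, _ => false

end

/-! The states split into a set `W` and its complement, with a witness for each player
(`exists_dichotomy`). On `W` there is a rank and a main move of player 1 such that each reply of
player 2 either gives reward 1 without leaving `W` or raising the rank, or lets some move of player
1 lower the rank in `W` with positive probability. Off `W`, player 2 has moves that avoid `W` for
sure and, against each move of player 1, give reward 0 or lower another rank with positive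
probability.

On `W`, player 1 plays the main move but trembles with summable probabilities. Consider the least
rank visited with positive probability. Trembling makes every available move possible, so player 2
almost surely never allows a descent below that rank; with positive probability the trembles also
stop deviating, and then every reward is 1 (`IsPositiveCertificate.positiveWinning`). Off `W`,
player 2 plays uniformly on safe moves. A potential, `2 ^ (-number of zeros)` times a rank weight,
contracts in expectation by a fixed factor, so by Markov and Borel-Cantelli zeros have frequency
bounded below (`exists_zeroCount_frequency`). All positive winning sets for thresholds close to 1
therefore equal `W`.

For the lower bounds: in `barG`, a repeated memory state along the loop makes the non-zero
probabilities of `a1` there bounded below, and player 2 can exploit this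
(`BarGame.memoryAfter_loop_injective`). In `underG`, patience below `m` leaves some move unplayed,
and player 1 answers with that index forever. -/

noncomputable section

/-! ### Expectations under discrete distributions -/

namespace PMF

variable {α β : Type*}

/-- The expectation of a `[0, ∞]`-valued function under a probability mass function. -/
def mean (p : PMF α) (f : α → ℝ≥0∞) : ℝ≥0∞ := ∑' a, p a * f a

theorem mean_const (p : PMF α) (c : ℝ≥0∞) : p.mean (fun _ => c) = c := by
  simp [mean, ENNReal.tsum_mul_right]

theorem mean_pure (a : α) (f : α → ℝ≥0∞) : (PMF.pure a).mean f = f a := by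
  classical
  rw [mean, tsum_eq_single a]
  · simp
  · intro b hb
    simp [hb]

theorem mean_bind (p : PMF α) (q : α → PMF β) (f : β → ℝ≥0∞) :
    (p.bind q).mean f = p.mean fun a => (q a).mean f := by
  simp only [mean, PMF.bind_apply, ← ENNReal.tsum_mul_right, ← ENNReal.tsum_mul_left]
  rw [ENNReal.tsum_comm]
  simp only [mul_assoc]

theorem mean_mono (p : PMF α) {f g : α → ℝ≥0∞} (h : ∀ a ∈ p.support, f a ≤ g a) :
    p.mean f ≤ p.mean g := by
  refine ENNReal.tsum_le_tsum fun a => ?_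
  by_cases ha : p a = 0
  · simp [ha]
  · exact mul_le_mul_right (h a ((p.mem_support_iff a).2 ha)) _

theorem mean_congr (p : PMF α) {f g : α → ℝ≥0∞} (h : ∀ a ∈ p.support, f a = g a) :
    p.mean f = p.mean g :=
  le_antisymm (p.mean_mono fun a ha => (h a ha).le) (p.mean_mono fun a ha => (h a ha).ge)

theorem mean_const_mul (p : PMF α) (c : ℝ≥0∞) (f : α → ℝ≥0∞) :
    p.mean (fun a => c * f a) = c * p.mean f := by
  simp only [mean, ← ENNReal.tsum_mul_left]
  exact tsum_congr fun a => mul_left_comm _ _ _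

theorem mean_add (p : PMF α) (f g : α → ℝ≥0∞) :
    p.mean (fun a => f a + g a) = p.mean f + p.mean g := by
  simp only [mean, mul_add, ENNReal.tsum_add]

theorem mean_eq_zero_iff (p : PMF α) (f : α → ℝ≥0∞) :
    p.mean f = 0 ↔ ∀ a ∈ p.support, f a = 0 := by
  simp only [mean, ENNReal.tsum_eq_zero, mul_eq_zero, PMF.mem_support_iff]
  exact forall_congr' fun a => or_iff_not_imp_left

/-- If `f` is bounded by `M`, and by `m` at one point of mass at least `q`, its expectation is at
most `(1 - q) M + q m`. -/
theorem mean_add_mul_le (p : PMF α) {f : α → ℝ≥0∞} {M m q : ℝ≥0∞} (hM : ∀ a ∈ p.support, f a ≤ M)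
    (hm : m ≤ M) {a : α} (ha : f a ≤ m) (hq : q ≤ p a) : p.mean f + q * M ≤ M + q * m := by
  classical
  obtain ⟨d, rfl⟩ := exists_add_of_le hm
  have h1 : p.mean f + p a * d ≤ m + d := by
    have h2 : p.mean (fun b => f b + if b = a then d else 0) ≤ m + d := by
      rw [← p.mean_const (m + d)]
      refine p.mean_mono fun b hb => ?_
      split_ifs with h
      · subst h
        gcongr
      · simpa using hM b hb
    refine le_trans (le_of_eq ?_) h2
    rw [mean_add]
    congr 1
    rw [mean, tsum_eq_single a]
    · simp
    · intro b hb
      simp [hb]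
  calc p.mean f + q * (m + d) = (p.mean f + q * d) + q * m := by ring
    _ ≤ (p.mean f + p a * d) + q * m := by gcongr
    _ ≤ _ := by gcongr

theorem lintegral_toMeasure_eq_mean [MeasurableSpace α] [DiscreteMeasurableSpace α] [Countable α]
    (p : PMF α) (f : α → ℝ≥0∞) : ∫⁻ a, f a ∂p.toMeasure = p.mean f := by
  rw [lintegral_countable']
  refine tsum_congr fun a => ?_
  rw [p.toMeasure_apply_singleton a (MeasurableSet.singleton a), mul_comm]

end PMF

/-! ### The law of a play, round by round -/

namespace ConcurrentGame

variable {S A : Type*}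

/-- The list of the first `n` rounds of a play. -/
def pre (n : ℕ) (π : ℕ → Step S A) : List (Step S A) := List.ofFn fun i : Fin n => π i

@[simp]
theorem length_pre (n : ℕ) (π : ℕ → Step S A) : (pre n π).length = n := by simp [pre]

theorem pre_succ (n : ℕ) (π : ℕ → Step S A) : pre (n + 1) π = pre n π ++ [π n] := by
  rw [pre, List.ofFn_succ', List.concat_eq_append]
  rfl

/-- The expectation of a function of the next round, when the history is `h` and the state `t`. -/
theorem mean_roundLaw (G : ConcurrentGame S A) (σ₁ : Strategy G.moves₁) (σ₂ : Strategy G.moves₂)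
    (h : List (Step S A)) (t : S) (f : Step S A → ℝ≥0∞) :
    (G.roundLaw σ₁ σ₂ h t).mean f =
      (σ₁.move h t).mean fun a => (σ₂.move h t).mean fun b => f ⟨t, a, b⟩ := by
  simp only [roundLaw, PMF.mean_bind, PMF.mean_pure]

variable [Finite S] [Finite A]

/-- The function factors through the first `n + 1` coordinates, which range over a finite discrete
space, so no measurability hypothesis is needed. -/
theorem measurable_pre_eval {β : Type*} [MeasurableSpace β] (n : ℕ)
    (F : List (Step S A) → Step S A → β) :
    Measurable fun π : ℕ → Step S A => F (pre n π) (π n) := by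
  have h : (fun π : ℕ → Step S A => F (pre n π) (π n)) =
      (fun x : (i : Finset.Iic n) → Step S A =>
        F (List.ofFn fun i : Fin n => x ⟨i, Finset.mem_Iic.2 i.2.le⟩)
          (x ⟨n, Finset.mem_Iic.2 le_rfl⟩)) ∘ Preorder.frestrictLe n := rfl
  rw [h]
  exact (measurable_of_finite _).comp (Preorder.measurable_frestrictLe n)

variable (G : ConcurrentGame S A) (σ₁ : Strategy G.moves₁) (σ₂ : Strategy G.moves₂) (s : S)

instance : IsProbabilityMeasure (G.playMeasure σ₁ σ₂ s) := by
  unfold playMeasure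
  infer_instance

theorem lintegral_round_zero (F : Step S A → ℝ≥0∞) :
    ∫⁻ π, F (π 0) ∂G.playMeasure σ₁ σ₂ s = (G.roundLaw σ₁ σ₂ [] s).mean F := by
  rw [← PMF.lintegral_toMeasure_eq_mean]
  have hF : Measurable F := measurable_of_finite F
  have h : (G.playMeasure σ₁ σ₂ s).map (fun π => π 0) = (G.roundLaw σ₁ σ₂ [] s).toMeasure := by
    have e : (fun π : ℕ → Step S A => π 0) =
      (MeasurableEquiv.piUnique (fun _ : Finset.Iic 0 => Step S A)) ∘ Preorder.frestrictLe 0 := rfl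
    rw [e, ← Measure.map_map (by fun_prop) (by fun_prop), playMeasure, Kernel.trajMeasure,
      Measure.map_comp _ _ (by fun_prop), Kernel.traj_map_frestrictLe, Kernel.partialTraj_self,
      Measure.id_comp, Measure.map_map (by fun_prop) (by fun_prop)]
    exact Measure.map_id
  rw [← h, lintegral_map hF (by fun_prop)]

theorem lintegral_round_succ (n : ℕ) (F : List (Step S A) → Step S A → ℝ≥0∞) :
    ∫⁻ π, F (pre (n + 1) π) (π (n + 1)) ∂G.playMeasure σ₁ σ₂ s =
      ∫⁻ π, (G.trans (π n).st (π n).act₁ (π n).act₂).mean (fun t =>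
        (G.roundLaw σ₁ σ₂ (pre (n + 1) π) t).mean (F (pre (n + 1) π)))
          ∂G.playMeasure σ₁ σ₂ s := by
  have h := Kernel.map_frestrictLe_trajMeasure_compProd_eq_map_trajMeasure
    (X := fun _ => Step S A) (μ₀ := (G.roundLaw σ₁ σ₂ [] s).toMeasure)
    (κ := G.roundKernel σ₁ σ₂) (a := n)
  let Φ : ((i : Finset.Iic n) → Step S A) × Step S A → ℝ≥0∞ := fun x => F (historyList x.1) x.2
  have hΦ : Measurable Φ := measurable_of_finite Φ
  have h2 := congrArg (fun ν => ∫⁻ x, Φ x ∂ν) h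
  beta_reduce at h2
  rw [lintegral_map hΦ (by fun_prop), Measure.lintegral_compProd hΦ,
    lintegral_map (measurable_of_finite _) (by fun_prop)] at h2
  refine h2.symm.trans (lintegral_congr fun π => ?_)
  -- `historyList` of the restriction to rounds `0, …, n` is `pre (n + 1) π` by definition.
  change ∫⁻ y, F (pre (n + 1) π) y ∂(G.nextRound σ₁ σ₂ n (Preorder.frestrictLe n π)).toMeasure = _
  rw [PMF.lintegral_toMeasure_eq_mean, nextRound, PMF.mean_bind]
  rfl

/-- The moves of round `n` are drawn independently, given the history and the current state. -/
theorem lintegral_round (n : ℕ) (F : List (Step S A) → Step S A → ℝ≥0∞) :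
    ∫⁻ π, F (pre n π) (π n) ∂G.playMeasure σ₁ σ₂ s =
      ∫⁻ π, (σ₁.move (pre n π) (π n).st).mean (fun a => (σ₂.move (pre n π) (π n).st).mean fun b =>
        F (pre n π) ⟨(π n).st, a, b⟩) ∂G.playMeasure σ₁ σ₂ s := by
  cases n with
  | zero =>
    refine (lintegral_round_zero G σ₁ σ₂ s (F [])).trans (Eq.trans ?_
      (lintegral_round_zero G σ₁ σ₂ s (fun y => (σ₁.move [] y.st).mean (fun a =>
        (σ₂.move [] y.st).mean fun b => F [] ⟨y.st, a, b⟩))).symm)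
    simp only [mean_roundLaw, PMF.mean_const]
  | succ n =>
    rw [lintegral_round_succ, lintegral_round_succ G σ₁ σ₂ s n (fun h y =>
      (σ₁.move h y.st).mean (fun a => (σ₂.move h y.st).mean fun b => F h ⟨y.st, a, b⟩))]
    simp only [mean_roundLaw, PMF.mean_const]

/-- The law of the state of round `n + 1`, given the first `n + 1` rounds. -/
theorem lintegral_state_succ (n : ℕ) (F : List (Step S A) → S → ℝ≥0∞) :
    ∫⁻ π, F (pre (n + 1) π) (π (n + 1)).st ∂G.playMeasure σ₁ σ₂ s =
      ∫⁻ π, (G.trans (π n).st (π n).act₁ (π n).act₂).mean (F (pre (n + 1) π))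
        ∂G.playMeasure σ₁ σ₂ s := by
  rw [lintegral_round_succ G σ₁ σ₂ s n (fun h y => F h y.st)]
  simp only [mean_roundLaw, PMF.mean_const]

theorem ae_state_zero : ∀ᵐ π ∂G.playMeasure σ₁ σ₂ s, (π 0).st = s := by
  classical
  have h := lintegral_round_zero G σ₁ σ₂ s (fun y => if y.st = s then 0 else 1)
  simp only [mean_roundLaw, if_true, PMF.mean_const] at h
  rw [lintegral_eq_zero_iff
    (measurable_pre_eval 0 (fun _ y => if y.st = s then (0 : ℝ≥0∞) else 1))] at h
  filter_upwards [h] with π hπ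
  by_contra hc
  simp [hc] at hπ

theorem ae_act_mem_support (n : ℕ) : ∀ᵐ π ∂G.playMeasure σ₁ σ₂ s,
    (π n).act₁ ∈ (σ₁.move (pre n π) (π n).st).support ∧
      (π n).act₂ ∈ (σ₂.move (pre n π) (π n).st).support := by
  classical
  let F : List (Step S A) → Step S A → ℝ≥0∞ := fun h y =>
    if y.act₁ ∈ (σ₁.move h y.st).support ∧ y.act₂ ∈ (σ₂.move h y.st).support then 0 else 1
  have h := lintegral_round G σ₁ σ₂ s n F
  have h0 : ∫⁻ π, F (pre n π) (π n) ∂G.playMeasure σ₁ σ₂ s = 0 := by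
    rw [h, lintegral_eq_zero_iff (measurable_pre_eval n fun h y => (σ₁.move h y.st).mean
      fun a => (σ₂.move h y.st).mean fun b => F h ⟨y.st, a, b⟩)]
    refine ae_of_all _ fun π => ?_
    simp only [Pi.zero_apply, PMF.mean_eq_zero_iff]
    intro a ha b hb
    exact if_pos ⟨ha, hb⟩
  rw [lintegral_eq_zero_iff (measurable_pre_eval n F)] at h0
  filter_upwards [h0] with π hπ
  by_contra hc
  exact one_ne_zero ((if_neg hc).symm.trans hπ)

theorem ae_state_succ_mem_support (n : ℕ) : ∀ᵐ π ∂G.playMeasure σ₁ σ₂ s,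
    (π (n + 1)).st ∈ (G.trans (π n).st (π n).act₁ (π n).act₂).support := by
  classical
  -- `lintegral_state_succ` only sees the history and the new state, so the previous round is read
  -- off as the last entry of the history. The value at the empty history is never used.
  let q : List (Step S A) → S → ℝ≥0∞ := fun h t =>
    match h.getLast? with
    | none => 0
    | some x => if t ∈ (G.trans x.st x.act₁ x.act₂).support then 0 else 1
  have hq : ∀ π t, q (pre (n + 1) π) t =
      if t ∈ (G.trans (π n).st (π n).act₁ (π n).act₂).support then 0 else 1 := by
    intro π t
    simp [q, pre_succ]
  have h0 := lintegral_state_succ G σ₁ σ₂ s n q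
  have h1 : ∀ π, (G.trans (π n).st (π n).act₁ (π n).act₂).mean (q (pre (n + 1) π)) = 0 := by
    intro π
    rw [PMF.mean_eq_zero_iff]
    intro t ht
    rw [hq, if_pos ht]
  simp only [h1, lintegral_zero] at h0
  rw [lintegral_eq_zero_iff (measurable_pre_eval (n + 1) fun h y => q h y.st)] at h0
  filter_upwards [h0] with π hπ
  by_contra hc
  exact one_ne_zero ((if_neg hc).symm.trans ((hq _ _).symm.trans hπ))

end ConcurrentGame


/-! ### Quantitative bounds on means and probabilities -/

theorem PMF.mean_le_ofReal {α : Type*} (p : PMF α) {f : α → ℝ≥0∞} {M m q : ℝ}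
    (hM : ∀ a ∈ p.support, f a ≤ ENNReal.ofReal M) (hm0 : 0 ≤ m) (hm : m ≤ M) (hq0 : 0 ≤ q)
    {a : α} (ha : f a ≤ ENNReal.ofReal m) (hq : ENNReal.ofReal q ≤ p a) :
    p.mean f ≤ ENNReal.ofReal (M - q * (M - m)) := by
  have h := p.mean_add_mul_le hM (ENNReal.ofReal_le_ofReal hm) ha hq
  have hM0 : 0 ≤ M := hm0.trans hm
  rw [← ENNReal.ofReal_mul hq0, ← ENNReal.ofReal_mul hq0,
    ← ENNReal.ofReal_add hM0 (mul_nonneg hq0 hm0)] at h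
  have h2 := ENNReal.le_sub_of_add_le_right ENNReal.ofReal_ne_top h
  rw [← ENNReal.ofReal_sub _ (mul_nonneg hq0 hM0)] at h2
  refine h2.trans (le_of_eq ?_)
  congr 1
  ring

/-- Finitely many non-zero values have a positive minimum. This turns "with positive probability"
into "with probability at least `p`", uniformly over a finite game. -/
theorem Finite.exists_pos_real_le {ι : Type*} [Finite ι] (f : ι → ℝ≥0∞) :
    ∃ p : ℝ, 0 < p ∧ p ≤ 1 ∧ ∀ i, f i ≠ 0 → ENNReal.ofReal p ≤ f i := by
  classical
  have := Fintype.ofFinite ι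
  -- Zeros become 1 so that they do not affect the minimum; the outer minimum with 1 keeps it finite
  -- when `ι` is empty.
  let g : ι → ℝ≥0∞ := fun i => if f i = 0 then 1 else min 1 (f i)
  let x : ℝ≥0∞ := min 1 (Finset.univ.inf g)
  have hx1 : x ≤ 1 := min_le_left _ _
  have hxt : x ≠ ∞ := ne_top_of_le_ne_top ENNReal.one_ne_top hx1
  have hx0 : 0 < x := by
    refine lt_min one_pos ((Finset.lt_inf_iff (by simp)).2 fun i _ => ?_)
    dsimp only [g]
    split_ifs with h
    · exact one_pos
    · exact lt_min one_pos (pos_iff_ne_zero.2 h)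
  refine ⟨x.toReal, ENNReal.toReal_pos hx0.ne' hxt, ?_, fun i hi => ?_⟩
  · simpa using ENNReal.toReal_mono ENNReal.one_ne_top hx1
  · rw [ENNReal.ofReal_toReal hxt]
    refine (min_le_right _ _).trans ((Finset.inf_le (Finset.mem_univ i)).trans ?_)
    simp [g, hi]

namespace ConcurrentGame

variable {S A : Type*} (G : ConcurrentGame S A)

/-! ### Average rewards and the number of zero rewards -/

section Averages

theorem avgReward_nonneg (π : ℕ → Step S A) (n : ℕ) : 0 ≤ G.avgReward π n := by
  unfold avgReward
  refine mul_nonneg (by positivity) (Finset.sum_nonneg fun i _ => ?_)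
  split_ifs <;> norm_num

theorem avgReward_le_one (π : ℕ → Step S A) (n : ℕ) : G.avgReward π n ≤ 1 := by
  unfold avgReward
  have h : (∑ i ∈ Finset.range n,
      if G.reward (π i).st (π i).act₁ (π i).act₂ then (1 : ℝ) else 0) ≤ n := by
    refine (Finset.sum_le_card_nsmul _ _ 1 fun i _ => ?_).trans (by simp)
    split_ifs <;> norm_num
  rcases Nat.eq_zero_or_pos n with rfl | hn
  · simp
  · rw [one_div, inv_mul_le_iff₀ (by positivity)]
    simpa using h

theorem isBoundedUnder_ge_avgReward (π : ℕ → Step S A) :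
    IsBoundedUnder (· ≥ ·) atTop (G.avgReward π) :=
  isBoundedUnder_of ⟨0, fun n => G.avgReward_nonneg π n⟩

theorem isBoundedUnder_le_avgReward (π : ℕ → Step S A) :
    IsBoundedUnder (· ≤ ·) atTop (G.avgReward π) :=
  isBoundedUnder_of ⟨1, fun n => G.avgReward_le_one π n⟩

theorem liminf_avgReward_le_limsup (π : ℕ → Step S A) :
    liminf (G.avgReward π) atTop ≤ limsup (G.avgReward π) atTop :=
  liminf_le_limsup (G.isBoundedUnder_le_avgReward π) (G.isBoundedUnder_ge_avgReward π)

theorem limInfAvg_subset_limSupAvg (l : ℝ) : G.LimInfAvg l ⊆ G.LimSupAvg l :=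
  fun π hπ => le_trans hπ (G.liminf_avgReward_le_limsup π)

/-- If the rewards are eventually constant, the averages converge to that constant. -/
theorem tendsto_avgReward (π : ℕ → Step S A) {r : Bool} {N : ℕ}
    (h : ∀ n ≥ N, G.reward (π n).st (π n).act₁ (π n).act₂ = r) :
    Tendsto (G.avgReward π) atTop (nhds (if r then 1 else 0)) := by
  have h1 : Tendsto (fun i => if G.reward (π i).st (π i).act₁ (π i).act₂ then (1 : ℝ) else 0)
      atTop (nhds (if r then 1 else 0)) :=
    tendsto_const_nhds.congr' (eventually_atTop.2 ⟨N, fun n hn => by simp only [h n hn]⟩)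
  refine h1.cesaro.congr fun n => ?_
  simp [avgReward]

/-- The number of rounds with reward 0 in a history. -/
def zeroCount (h : List (Step S A)) : ℕ := h.countP fun y => !G.reward y.st y.act₁ y.act₂

theorem zeroCount_pre_succ (n : ℕ) (π : ℕ → Step S A) :
    G.zeroCount (pre (n + 1) π) = G.zeroCount (pre n π) +
      if G.reward (π n).st (π n).act₁ (π n).act₂ then 0 else 1 := by
  cases h : G.reward (π n).st (π n).act₁ (π n).act₂ <;> simp [zeroCount, pre_succ, h]

theorem sum_reward_add_zeroCount (n : ℕ) (π : ℕ → Step S A) :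
    (∑ i ∈ Finset.range n, if G.reward (π i).st (π i).act₁ (π i).act₂ then (1 : ℝ) else 0) +
      G.zeroCount (pre n π) = n := by
  induction n with
  | zero => simp [zeroCount, pre]
  | succ n ih =>
    rw [Finset.sum_range_succ, zeroCount_pre_succ]
    push_cast
    split_ifs <;> linarith

theorem limsup_avgReward_le_of_zeroCount {π : ℕ → Step S A} {L : ℕ} (hL : 0 < L)
    (h : ∀ᶠ n in atTop, n < L * G.zeroCount (pre n π)) :
    limsup (G.avgReward π) atTop ≤ 1 - 1 / L := by
  refine limsup_le_of_le (G.isBoundedUnder_ge_avgReward π).isCoboundedUnder_le ?_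
  filter_upwards [h, eventually_gt_atTop 0] with n hn hn0
  have h1 := G.sum_reward_add_zeroCount n π
  have h2 : (n : ℝ) ≤ L * G.zeroCount (pre n π) := by exact_mod_cast hn.le
  have hn' : (0 : ℝ) < n := by exact_mod_cast hn0
  have hL' : (0 : ℝ) < L := by exact_mod_cast hL
  have h3 : (n : ℝ) / L ≤ G.zeroCount (pre n π) := by rwa [div_le_iff₀' hL']
  rw [avgReward, one_div, inv_mul_le_iff₀ hn']
  have h4 : (n : ℝ) * (1 - 1 / L) = n - n / L := by ring
  linarith

end Averages

/-! ### A contracting potential for player 2 -/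

section Potential

variable {G}

/-- Weight of a state in the potential function: close to, and below, 2 when the rank is high. -/
def rankWeight (ρ : S → ℕ) (u : ℝ) (s : S) : ℝ := 2 - u ^ (ρ s + 1)

theorem rankWeight_le {ρ : S → ℕ} {u : ℝ} (hu : 0 < u) (s : S) : rankWeight ρ u s ≤ 2 := by
  have : 0 < u ^ (ρ s + 1) := by positivity
  unfold rankWeight
  linarith

theorem one_le_rankWeight {ρ : S → ℕ} {u : ℝ} (hu : 0 < u) (hu1 : u ≤ 1) (s : S) :
    1 ≤ rankWeight ρ u s := by
  have : u ^ (ρ s + 1) ≤ 1 := pow_le_one₀ hu.le hu1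
  unfold rankWeight
  linarith

/-- One round contracts the potential. Write `u = p ^ 2 / 2`. For the good move `b`, a zero halves a
weight of at most 2, and a descent with probability `p` gives at most `2 - p * u ^ ρ s`; the second
bound covers both cases. Since `b` has probability at least `p`, the mean is at most `2 - p ^ 2 * u
^ ρ s = 2 - 2 * u ^ (ρ s + 1)`, which is `u ^ (ρ s + 1)` below the current weight. As weights are at
most 2 and ranks at most `K`, this is a uniform factor. -/
theorem mean_weighted_rankWeight_le {ρ : S → ℕ} {p : ℝ} (hp : 0 < p) (hp1 : p ≤ 1) {K : ℕ} {s : S}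
    (hK : ρ s ≤ K) {a : A} {q : PMF A}
    (hprog : ∃ b, ENNReal.ofReal p ≤ q b ∧ (G.reward s a b = false ∨
      ∃ t, ENNReal.ofReal p ≤ G.trans s a b t ∧ ρ t < ρ s)) :
    q.mean (fun b => (2⁻¹ : ℝ≥0∞) ^ (if G.reward s a b then 0 else 1) *
      (G.trans s a b).mean fun t => ENNReal.ofReal (rankWeight ρ (p ^ 2 / 2) t)) ≤
      ENNReal.ofReal (1 - (p ^ 2 / 2) ^ (K + 1) / 2) *
        ENNReal.ofReal (rankWeight ρ (p ^ 2 / 2) s) := by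
  set u : ℝ := p ^ 2 / 2 with hu
  have hu0 : 0 < u := by positivity
  have hu1 : u ≤ 1 := by nlinarith
  have hg2 : ∀ a b, (G.trans s a b).mean (fun t => ENNReal.ofReal (rankWeight ρ u t)) ≤
      ENNReal.ofReal 2 := fun a b => by
    rw [← PMF.mean_const (G.trans s a b) (ENNReal.ofReal 2)]
    exact PMF.mean_mono _ fun t _ => ENNReal.ofReal_le_ofReal (rankWeight_le hu0 t)
  have hx0 : 0 < u ^ ρ s := by positivity
  have hx1 : u ^ ρ s ≤ 1 := pow_le_one₀ hu0.le hu1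
  have hpx : p * u ^ ρ s ≤ 1 := by nlinarith
  have hpx0 : 0 < p * u ^ ρ s := by positivity
  have hw1 : ∀ k : ℕ, (2⁻¹ : ℝ≥0∞) ^ k ≤ 1 := fun k => pow_le_one₀ zero_le (by simp)
  obtain ⟨b, hb, hb'⟩ := hprog
  have key := q.mean_le_ofReal (f := fun b => (2⁻¹ : ℝ≥0∞) ^ (if G.reward s a b then 0 else 1) *
      (G.trans s a b).mean fun t => ENNReal.ofReal (rankWeight ρ u t)) (M := 2)
      (m := 2 - p * u ^ ρ s) (q := p) (a := b) ?_ (by linarith) (by linarith) hp.le ?_ hb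
  · refine key.trans ?_
    have hθ : 0 ≤ 1 - u ^ (K + 1) / 2 := by
      have : u ^ (K + 1) ≤ 1 := pow_le_one₀ hu0.le hu1
      linarith
    rw [← ENNReal.ofReal_mul hθ]
    refine ENNReal.ofReal_le_ofReal ?_
    have hy : u ^ (K + 1) ≤ u ^ (ρ s + 1) := pow_le_pow_of_le_one hu0.le hu1 (by omega)
    have hy0 : 0 < u ^ (K + 1) := by positivity
    have hxx : p * (p * u ^ ρ s) = 2 * u ^ (ρ s + 1) := by
      rw [pow_succ, hu]
      ring
    have hpos : 0 < u ^ (K + 1) * u ^ (ρ s + 1) := by positivity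
    unfold rankWeight
    nlinarith
  · intro b _
    calc _ ≤ 1 * ENNReal.ofReal 2 := mul_le_mul' (hw1 _) (hg2 _ _)
      _ = _ := one_mul _
  · rcases hb' with hr | ⟨t, ht, htρ⟩
    · have h1 : (2⁻¹ : ℝ≥0∞) * ENNReal.ofReal 2 = 1 := by
        simp [ENNReal.inv_mul_cancel]
      simp only [hr, Bool.false_eq_true, if_false, pow_one]
      calc _ ≤ (2⁻¹ : ℝ≥0∞) * ENNReal.ofReal 2 := by gcongr; exact hg2 _ _
        _ = ENNReal.ofReal 1 := by rw [h1, ENNReal.ofReal_one]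
        _ ≤ _ := ENNReal.ofReal_le_ofReal (by linarith)
    · calc _ ≤ 1 * (G.trans s a b).mean (fun t => ENNReal.ofReal (rankWeight ρ u t)) := by
            gcongr; exact hw1 _
        _ = (G.trans s a b).mean (fun t => ENNReal.ofReal (rankWeight ρ u t)) := one_mul _
        _ ≤ ENNReal.ofReal (2 - p * (2 - (2 - u ^ ρ s))) := by
            refine PMF.mean_le_ofReal _ (fun t _ => ENNReal.ofReal_le_ofReal (rankWeight_le hu0 t))
              (by linarith) (by linarith) hp.le (a := t) ?_ ht
            refine ENNReal.ofReal_le_ofReal ?_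
            have : u ^ ρ s ≤ u ^ (ρ t + 1) := pow_le_pow_of_le_one hu0.le hu1 htρ
            unfold rankWeight
            linarith
        _ = _ := by congr 1; ring

variable [Finite S] [Finite A]

theorem ae_state_mem {Z : Set S} {σ₂ : Strategy G.moves₂}
    (hsafe : ∀ h, ∀ s ∈ Z, ∀ a ∈ G.moves₁ s, ∀ b ∈ (σ₂.move h s).support,
      (G.trans s a b).support ⊆ Z) (σ₁ : Strategy G.moves₁) {s : S} (hs : s ∈ Z) :
    ∀ᵐ π ∂G.playMeasure σ₁ σ₂ s, ∀ n, (π n).st ∈ Z := by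
  filter_upwards [G.ae_state_zero σ₁ σ₂ s, ae_all_iff.2 (G.ae_act_mem_support σ₁ σ₂ s),
    ae_all_iff.2 (G.ae_state_succ_mem_support σ₁ σ₂ s)] with π h0 h1 h2 n
  induction n with
  | zero => rwa [h0]
  | succ n ih =>
    exact hsafe _ _ ih _ (σ₁.support_subset _ _ (h1 n).1) _ (h1 n).2 (h2 n)

/-- Safety keeps the play in `Z`, so the one-round contraction iterates. The rank weight lies
between 1 and 2: the upper bound gives the final factor 2, and the lower bound lets the weight be
dropped at the end. -/
theorem lintegral_pow_zeroCount_le {Z : Set S} {ρ : S → ℕ} {σ₂ : Strategy G.moves₂} {p : ℝ}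
    (hp : 0 < p) (hp1 : p ≤ 1)
    (hsafe : ∀ h, ∀ s ∈ Z, ∀ a ∈ G.moves₁ s, ∀ b ∈ (σ₂.move h s).support,
      (G.trans s a b).support ⊆ Z)
    (hprog : ∀ h, ∀ s ∈ Z, ∀ a ∈ G.moves₁ s, ∃ b, ENNReal.ofReal p ≤ σ₂.move h s b ∧
      (G.reward s a b = false ∨ ∃ t, ENNReal.ofReal p ≤ G.trans s a b t ∧ ρ t < ρ s))
    {K : ℕ} (hK : ∀ s, ρ s ≤ K) (σ₁ : Strategy G.moves₁) {s : S} (hs : s ∈ Z) (n : ℕ) :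
    ∫⁻ π, (2⁻¹ : ℝ≥0∞) ^ G.zeroCount (pre n π) ∂G.playMeasure σ₁ σ₂ s ≤
      ENNReal.ofReal (1 - (p ^ 2 / 2) ^ (K + 1) / 2) ^ n * 2 := by
  have hu0 : 0 < p ^ 2 / 2 := by positivity
  have hu1 : p ^ 2 / 2 ≤ 1 := by nlinarith
  let g : S → ℝ≥0∞ := fun t => ENNReal.ofReal (rankWeight ρ (p ^ 2 / 2) t)
  set θ : ℝ≥0∞ := ENNReal.ofReal (1 - (p ^ 2 / 2) ^ (K + 1) / 2)
  have hstep : ∀ n, ∫⁻ π, 2⁻¹ ^ G.zeroCount (pre n π) * g (π n).st ∂G.playMeasure σ₁ σ₂ s ≤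
      θ ^ n * 2 := by
    intro n
    induction n with
    | zero =>
      have h2 : ∀ π : ℕ → Step S A, 2⁻¹ ^ G.zeroCount (pre 0 π) * g (π 0).st ≤ 2 := fun π => by
        have h3 : g (π 0).st ≤ ENNReal.ofReal 2 := ENNReal.ofReal_le_ofReal (rankWeight_le hu0 _)
        simpa [zeroCount, pre] using h3
      refine (lintegral_mono h2).trans ?_
      simp
    | succ n ih =>
      rw [G.lintegral_state_succ σ₁ σ₂ s n (fun h t => 2⁻¹ ^ G.zeroCount h * g t)]
      simp only [PMF.mean_const_mul, zeroCount_pre_succ, pow_add, mul_assoc]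
      rw [G.lintegral_round σ₁ σ₂ s n (fun h y => 2⁻¹ ^ G.zeroCount h *
        (2⁻¹ ^ (if G.reward y.st y.act₁ y.act₂ then 0 else 1) *
          (G.trans y.st y.act₁ y.act₂).mean g))]
      simp only [PMF.mean_const_mul]
      have hb : ∀ᵐ π ∂G.playMeasure σ₁ σ₂ s,
          2⁻¹ ^ G.zeroCount (pre n π) * (σ₁.move (pre n π) (π n).st).mean (fun a =>
            (σ₂.move (pre n π) (π n).st).mean fun b =>
              2⁻¹ ^ (if G.reward (π n).st a b then 0 else 1) * (G.trans (π n).st a b).mean g) ≤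
          θ *
            (2⁻¹ ^ G.zeroCount (pre n π) * g (π n).st) := by
        filter_upwards [ae_state_mem hsafe σ₁ hs] with π hπ
        rw [mul_left_comm θ]
        gcongr
        rw [← PMF.mean_const (σ₁.move (pre n π) (π n).st) (θ * _)]
        exact PMF.mean_mono _ fun a ha => mean_weighted_rankWeight_le hp hp1 (hK _)
          (hprog _ _ (hπ n) a (σ₁.support_subset _ _ ha))
      refine (lintegral_mono_ae hb).trans ?_
      rw [lintegral_const_mul _
        (measurable_pre_eval n fun h y => 2⁻¹ ^ G.zeroCount h * g y.st)]
      calc _ ≤ θ * (θ ^ n * 2) := mul_le_mul_right ih θ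
        _ = _ := by ring
  refine (lintegral_mono fun π => ?_).trans (hstep n)
  exact le_mul_of_one_le_right' (by
    simpa [g] using one_le_rankWeight (ρ := ρ) hu0 hu1 (π n).st)

/-- If player 2 makes progress towards a reward 0 with probability bounded below, the rounds with
reward 0 have positive frequency almost surely, uniformly in the strategy of player 1. -/
theorem exists_zeroCount_frequency {Z : Set S} {ρ : S → ℕ} {σ₂ : Strategy G.moves₂} {p : ℝ}
    (hp : 0 < p) (hp1 : p ≤ 1)
    (hsafe : ∀ h, ∀ s ∈ Z, ∀ a ∈ G.moves₁ s, ∀ b ∈ (σ₂.move h s).support,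
      (G.trans s a b).support ⊆ Z)
    (hprog : ∀ h, ∀ s ∈ Z, ∀ a ∈ G.moves₁ s, ∃ b, ENNReal.ofReal p ≤ σ₂.move h s b ∧
      (G.reward s a b = false ∨ ∃ t, ENNReal.ofReal p ≤ G.trans s a b t ∧ ρ t < ρ s)) :
    ∃ L : ℕ, 0 < L ∧ ∀ (σ₁ : Strategy G.moves₁), ∀ s ∈ Z, ∀ᵐ π ∂G.playMeasure σ₁ σ₂ s,
      ∀ᶠ n in atTop, n < L * G.zeroCount (pre n π) := by
  obtain ⟨K, hK⟩ : ∃ K, ∀ s, ρ s ≤ K := by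
    obtain ⟨K, hK⟩ := (Set.finite_range ρ).bddAbove
    exact ⟨K, fun s => hK ⟨s, rfl⟩⟩
  have hu0 : 0 < p ^ 2 / 2 := by positivity
  have hu1 : p ^ 2 / 2 ≤ 1 := by nlinarith
  set y : ℝ := (p ^ 2 / 2) ^ (K + 1) with hy
  have hy0 : 0 < y := by positivity
  have hy1 : y ≤ 1 := pow_le_one₀ hu0.le hu1
  have hφ0 : 0 < 1 - y / 4 := by linarith
  -- With `φ = 1 - y / 4`, the contraction factor `1 - y / 2` is at most `φ * φ`. Markov's
  -- inequality at level `2⁻¹ ^ (n / L)` costs a factor `2 ^ (n / L)`; the choice of `L` lets one `φ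
  -- ^ n` absorb it, and the other `φ ^ n` is summable.
  obtain ⟨L, hL⟩ := exists_pow_lt_of_lt_one (show (0 : ℝ) < 1 / 2 by norm_num)
    (show 1 - y / 4 < 1 by linarith)
  have hL0 : 0 < L := by
    rcases Nat.eq_zero_or_pos L with rfl | h
    · norm_num at hL
    · exact h
  refine ⟨L, hL0, fun σ₁ s hs => ?_⟩
  set φ : ℝ≥0∞ := ENNReal.ofReal (1 - y / 4) with hφ
  have hφ1 : φ < 1 := by
    rw [hφ, ← ENNReal.ofReal_one]
    exact (ENNReal.ofReal_lt_ofReal_iff one_pos).2 (by linarith)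
  have hφL : 2 * φ ^ L ≤ 1 := by
    rw [hφ, ← ENNReal.ofReal_pow hφ0.le, ← ENNReal.ofReal_ofNat 2,
      ← ENNReal.ofReal_mul (by norm_num), ← ENNReal.ofReal_one]
    exact ENNReal.ofReal_le_ofReal (by norm_num at hL ⊢; linarith)
  have hθφ : ENNReal.ofReal (1 - y / 2) ≤ φ * φ := by
    rw [hφ, ← ENNReal.ofReal_mul hφ0.le]
    exact ENNReal.ofReal_le_ofReal (by nlinarith)
  have hbound : ∀ n, G.playMeasure σ₁ σ₂ s {π | L * G.zeroCount (pre n π) ≤ n} ≤ 2 * φ ^ n := by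
    intro n
    have h1 := lintegral_pow_zeroCount_le hp hp1 hsafe hprog hK σ₁ hs n
    have h2 := mul_meas_ge_le_lintegral (μ := G.playMeasure σ₁ σ₂ s)
      (measurable_pre_eval n fun h _ => (2⁻¹ : ℝ≥0∞) ^ G.zeroCount h) (2⁻¹ ^ (n / L))
    have h3 : {π | L * G.zeroCount (pre n π) ≤ n} ⊆
        {π : ℕ → Step S A | (2⁻¹ : ℝ≥0∞) ^ (n / L) ≤ 2⁻¹ ^ G.zeroCount (pre n π)} := by
      intro π hπ
      have h4 : G.zeroCount (pre n π) ≤ n / L :=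
        (Nat.le_div_iff_mul_le hL0).2 ((mul_comm _ _).trans_le hπ)
      exact pow_le_pow_of_le_one zero_le (ENNReal.inv_le_one.2 one_le_two) h4
    have h4 : G.playMeasure σ₁ σ₂ s {π | L * G.zeroCount (pre n π) ≤ n} ≤
        2 ^ (n / L) * ((φ * φ) ^ n * 2) := by
      have h5 : (2 : ℝ≥0∞) ^ (n / L) * 2⁻¹ ^ (n / L) = 1 := by
        rw [← mul_pow, ENNReal.mul_inv_cancel (by norm_num) (by norm_num), one_pow]
      calc _ ≤ G.playMeasure σ₁ σ₂ s _ := measure_mono h3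
        _ = 2 ^ (n / L) * (2⁻¹ ^ (n / L) * G.playMeasure σ₁ σ₂ s _) := by
          rw [← mul_assoc, h5, one_mul]
        _ ≤ _ := by
          refine mul_le_mul_right (h2.trans (h1.trans ?_)) _
          gcongr
    refine h4.trans ?_
    have h6 : (2 : ℝ≥0∞) ^ (n / L) * φ ^ n ≤ 1 := by
      calc (2 : ℝ≥0∞) ^ (n / L) * φ ^ n ≤ 2 ^ (n / L) * φ ^ (L * (n / L)) := by
            gcongr 2 ^ (n / L) * ?_
            exact pow_le_pow_of_le_one zero_le hφ1.le (Nat.mul_div_le n L)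
        _ = (2 * φ ^ L) ^ (n / L) := by rw [mul_pow, pow_mul]
        _ ≤ 1 := pow_le_one₀ zero_le hφL
    calc _ = ((2 : ℝ≥0∞) ^ (n / L) * φ ^ n) * (2 * φ ^ n) := by rw [mul_pow]; ring
      _ ≤ 1 * (2 * φ ^ n) := by gcongr
      _ = _ := one_mul _
  have hsum : ∑' n, G.playMeasure σ₁ σ₂ s {π | L * G.zeroCount (pre n π) ≤ n} ≠ ∞ := by
    refine ne_top_of_le_ne_top ?_ (ENNReal.tsum_le_tsum hbound)
    rw [ENNReal.tsum_mul_left, ENNReal.tsum_geometric]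
    refine ENNReal.mul_ne_top (by norm_num) (ENNReal.inv_ne_top.2 ?_)
    exact (tsub_pos_of_lt hφ1).ne'
  filter_upwards [ae_eventually_notMem hsum] with π hπ
  filter_upwards [hπ] with n hn
  exact not_le.1 hn

end Potential

end ConcurrentGame


/-! ### Trembling strategies of player 1 -/

namespace PMF

variable {α : Type*}

/-- With probability `ε`, draw uniformly from `s`; otherwise choose `a`. -/
def tremble (s : Finset α) (hs : s.Nonempty) (a : α) (ε : ℝ≥0∞) (hε : ε ≤ 1) : PMF α :=
  (PMF.ofFintype (fun i : Bool => if i then ε else 1 - ε) (by simp [hε])).bind fun i =>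
    if i then PMF.uniformOfFinset s hs else PMF.pure a

variable {s : Finset α} {hs : s.Nonempty} {a : α} {ε : ℝ≥0∞} {hε : ε ≤ 1}

theorem mean_tremble (f : α → ℝ≥0∞) : (tremble s hs a ε hε).mean f =
    ε * (PMF.uniformOfFinset s hs).mean f + (1 - ε) * f a := by
  rw [tremble, mean_bind, mean, tsum_bool, add_comm]
  simp [mean_pure]

theorem support_tremble_subset (ha : a ∈ s) : (tremble s hs a ε hε).support ⊆ s := by
  intro x hx
  rw [tremble, PMF.mem_support_bind_iff] at hx
  obtain ⟨i, -, hi⟩ := hx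
  cases i
  · simp only [Bool.false_eq_true, if_false, PMF.mem_support_pure_iff] at hi
    exact hi ▸ ha
  · simpa using hi

theorem mem_support_tremble (hε0 : ε ≠ 0) {x : α} (hx : x ∈ s) :
    x ∈ (tremble s hs a ε hε).support := by
  rw [tremble, PMF.mem_support_bind_iff]
  exact ⟨true, by simpa [PMF.mem_support_iff] using hε0, by simpa using hx⟩

theorem mean_tremble_ne_le [DecidableEq α] :
    (tremble s hs a ε hε).mean (fun x => if x = a then 0 else 1) ≤ ε := by
  rw [mean_tremble]
  simp only [if_true, mul_zero, add_zero]
  refine mul_le_of_le_one_right' ?_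
  refine le_trans (mean_mono _ fun x _ => ?_) ((PMF.uniformOfFinset s hs).mean_const 1).le
  split_ifs <;> simp

end PMF

theorem trembleRate_le_one (n : ℕ) : (2⁻¹ : ℝ≥0∞) ^ (n + 2) ≤ 1 :=
  pow_le_one₀ zero_le (ENNReal.inv_le_one.2 one_le_two)

/-- The exponent offset 2 makes the total deviation probability strictly less than 1; with offset 1
the sum would be 1 and the union bound would be void. -/
theorem tsum_trembleRate : ∑' n : ℕ, (2⁻¹ : ℝ≥0∞) ^ (n + 2) = 2⁻¹ := by
  simp only [pow_add]
  rw [ENNReal.tsum_mul_right, ENNReal.tsum_geometric, ENNReal.one_sub_inv_two, inv_inv, sq,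
    ← mul_assoc, ENNReal.mul_inv_cancel (by norm_num) (by norm_num), one_mul]

namespace ConcurrentGame

variable {S A : Type*} (G : ConcurrentGame S A)

/-- The Markov strategy that plays `main` except with probability `2 ^ -(n + 2)` in round `n`, when
it draws uniformly. -/
def trembling (main : S → A) (hmain : ∀ s, main s ∈ G.moves₁ s) : Strategy G.moves₁ where
  move h s := PMF.tremble (G.moves₁ s) (G.moves₁_nonempty s) (main s) (2⁻¹ ^ (h.length + 2))
    (trembleRate_le_one _)
  support_subset _ s := PMF.support_tremble_subset (hmain s)

/-- A certificate that player 1 wins positively from `W`: against each move of player 2, either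
`main` yields reward 1 and does not increase the rank, or some move decreases the rank with positive
probability. -/
def IsPositiveCertificate (W : Set S) (ρ : S → ℕ) (main : S → A) : Prop :=
  ∀ s ∈ W, ∀ b ∈ G.moves₂ s,
    (G.reward s (main s) b = true ∧
      ∀ t ∈ (G.trans s (main s) b).support, t ∈ W ∧ ρ t ≤ ρ s) ∨
    ∃ a ∈ G.moves₁ s, ∃ t ∈ (G.trans s a b).support, t ∈ W ∧ ρ t < ρ s

variable {G} {main : S → A} {hmain : ∀ s, main s ∈ G.moves₁ s}

theorem isMarkov_trembling : (G.trembling main hmain).IsMarkov := by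
  intro h h' hh s
  simp only [trembling, hh]

variable [Finite S] [Finite A] {s : S}

/-- The tremble of round `n` is drawn after the history and the current state are fixed, so the
bound on a deviation holds conditionally on any event they determine. -/
theorem measure_inter_tremble_le [DecidableEq A] (σ₂ : Strategy G.moves₂) (n : ℕ)
    (P : List (Step S A) → S → Prop) :
    G.playMeasure (G.trembling main hmain) σ₂ s
        {π | P (pre n π) (π n).st ∧ (π n).act₁ ≠ main (π n).st} ≤
      2⁻¹ ^ (n + 2) * G.playMeasure (G.trembling main hmain) σ₂ s {π | P (pre n π) (π n).st} := by
  classical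
  let f : List (Step S A) → Step S A → ℝ≥0∞ := fun h y => if P h y.st then 1 else 0
  let g : List (Step S A) → Step S A → ℝ≥0∞ := fun h y => if y.act₁ = main y.st then 0 else 1
  have hm1 : MeasurableSet {π : ℕ → Step S A | P (pre n π) (π n).st} :=
    measurableSet_setOfPred.2 (measurable_pre_eval n fun h y => P h y.st)
  have hm2 : MeasurableSet {π : ℕ → Step S A | P (pre n π) (π n).st ∧
      (π n).act₁ ≠ main (π n).st} :=
    measurableSet_setOfPred.2 (measurable_pre_eval n fun h y => P h y.st ∧ y.act₁ ≠ main y.st)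
  rw [← lintegral_indicator_one hm1, ← lintegral_indicator_one hm2]
  have e1 : ∀ π : ℕ → Step S A, {π : ℕ → Step S A | P (pre n π) (π n).st}.indicator 1 π =
      f (pre n π) (π n) := fun π => by simp [f, Set.indicator_apply]
  have e2 : ∀ π : ℕ → Step S A, {π : ℕ → Step S A | P (pre n π) (π n).st ∧
      (π n).act₁ ≠ main (π n).st}.indicator 1 π = f (pre n π) (π n) * g (pre n π) (π n) :=
    fun π => by
      by_cases h1 : P (pre n π) (π n).st <;> by_cases h2 : (π n).act₁ = main (π n).st <;>
        simp [f, g, h1, h2]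
  simp only [e1, e2]
  rw [lintegral_round _ _ _ _ n (fun h y => f h y * g h y), ← lintegral_const_mul _
    (measurable_pre_eval n f)]
  refine lintegral_mono fun π => ?_
  refine (PMF.mean_congr _ (g := fun a => f (pre n π) (π n) * if a = main (π n).st then 0 else 1)
    fun a _ => PMF.mean_const (σ₂.move (pre n π) (π n).st) _).trans_le ?_
  refine (PMF.mean_const_mul _ _ _).trans_le ?_
  rw [mul_comm]
  refine mul_le_mul_left 
    ((PMF.mean_tremble_ne_le (hε := trembleRate_le_one _)).trans ?_) _
  rw [length_pre]

/-- If almost surely no state of `B` is visited, then almost surely player 2 chooses moves for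
which no move of player 1 leads to `B`. -/
theorem ae_forall_trans_notMem (σ₂ : Strategy G.moves₂) (B : Set S) (n : ℕ)
    (hB : ∀ᵐ π ∂G.playMeasure (G.trembling main hmain) σ₂ s, (π (n + 1)).st ∉ B) :
    ∀ᵐ π ∂G.playMeasure (G.trembling main hmain) σ₂ s,
      ∀ a ∈ G.moves₁ (π n).st, ∀ t ∈ (G.trans (π n).st a (π n).act₂).support, t ∉ B := by
  classical
  let χ : S → ℝ≥0∞ := fun t => if t ∈ B then 1 else 0
  have h0 : ∫⁻ π, χ (π (n + 1)).st ∂G.playMeasure (G.trembling main hmain) σ₂ s = 0 := by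
    rw [lintegral_eq_zero_iff (measurable_pre_eval (n + 1) fun _ y => χ y.st)]
    filter_upwards [hB] with π hπ
    exact if_neg hπ
  rw [lintegral_state_succ _ _ _ _ n (fun _ => χ),
    lintegral_round _ _ _ _ n (fun _ y => (G.trans y.st y.act₁ y.act₂).mean χ),
    lintegral_eq_zero_iff (measurable_pre_eval n fun h y =>
      ((G.trembling main hmain).move h y.st).mean fun a => (σ₂.move h y.st).mean fun b =>
        (G.trans y.st a b).mean χ)] at h0
  filter_upwards [h0, G.ae_act_mem_support (G.trembling main hmain) σ₂ s n] with π hπ hact a ha t ht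
  simp only [Pi.zero_apply, PMF.mean_eq_zero_iff] at hπ
  -- Each available move has positive probability in each round, so a null event excludes every `a`,
  -- not only the one played.
  have h1 := hπ a (PMF.mem_support_tremble (hε := trembleRate_le_one _) (by simp) ha) _ hact.2 t ht
  by_contra hc
  exact one_ne_zero ((if_pos hc).symm.trans h1)

/-- A positive-probability event at time `N` is compatible with playing `main` forever. -/
theorem measure_forall_main_pos [DecidableEq A] (σ₂ : Strategy G.moves₂) (N : ℕ) (R : S → Prop)
    (hR : G.playMeasure (G.trembling main hmain) σ₂ s {π | R (π N).st} ≠ 0) :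
    0 < G.playMeasure (G.trembling main hmain) σ₂ s
      {π | R (π N).st ∧ ∀ n ≥ N, (π n).act₁ = main (π n).st} := by
  set μ := G.playMeasure (G.trembling main hmain) σ₂ s
  set C : Set (ℕ → Step S A) := {π | R (π N).st} with hC
  have hbad : ∀ n ≥ N, μ {π | π ∈ C ∧ (π n).act₁ ≠ main (π n).st} ≤ 2⁻¹ ^ (n + 2) * μ C := by
    intro n hn
    -- The event about time `N` is expressed through the history and the state of round `n ≥ N`.
    -- Appending the current state covers `n = N`; the default `False` is never reached.
    let P : List (Step S A) → S → Prop := fun h t =>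
      ((h.map Step.st ++ [t])[N]?).elim False R
    have hP : ∀ π, P (pre n π) (π n).st ↔ π ∈ C := by
      intro π
      have h1 : (pre n π).map Step.st ++ [(π n).st] = (pre (n + 1) π).map Step.st := by
        simp [pre_succ]
      have h2 : ((pre (n + 1) π).map Step.st)[N]? = some (π N).st := by
        have : N < n + 1 := by omega
        simp [pre, this, -List.ofFn_succ]
      simp only [P, h1, h2, Option.elim_some]
      rfl
    have := measure_inter_tremble_le (hmain := hmain) (s := s) σ₂ n P
    simp only [hP] at this
    exact this
  have hsub : C ⊆ {π | R (π N).st ∧ ∀ n ≥ N, (π n).act₁ = main (π n).st} ∪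
      ⋃ k, {π | π ∈ C ∧ (π (N + k)).act₁ ≠ main (π (N + k)).st} := by
    intro π hπ
    by_cases h : ∀ n ≥ N, (π n).act₁ = main (π n).st
    · exact Or.inl ⟨hπ, h⟩
    · push Not at h
      obtain ⟨n, hn, h⟩ := h
      refine Or.inr (Set.mem_iUnion.2 ⟨n - N, hπ, ?_⟩)
      rwa [Nat.add_sub_cancel' hn]
  have hU : μ (⋃ k, {π | π ∈ C ∧ (π (N + k)).act₁ ≠ main (π (N + k)).st}) ≤ 2⁻¹ * μ C := by
    refine (measure_iUnion_le _).trans ?_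
    rw [← tsum_trembleRate, ← ENNReal.tsum_mul_right]
    refine ENNReal.tsum_le_tsum fun k => (hbad (N + k) (by omega)).trans ?_
    gcongr 1
    exact pow_le_pow_of_le_one zero_le (ENNReal.inv_le_one.2 one_le_two) (by omega)
  rw [pos_iff_ne_zero]
  intro h0
  have h1 : μ C ≤ 2⁻¹ * μ C := by
    calc μ C ≤ _ := measure_mono hsub
      _ ≤ _ := measure_union_le _ _
      _ ≤ 2⁻¹ * μ C := by rw [h0, zero_add]; exact hU
  have h2 : 2⁻¹ * μ C < μ C := by
    conv_rhs => rw [← one_mul (μ C)]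
    exact ENNReal.mul_lt_mul_left hR (measure_ne_top _ _) (by simp)
  exact absurd h1 (not_le.2 h2)

/-- Let `k` be the least rank visited in `W` with positive probability, say at time `N`. Lower ranks
in `W` are almost surely never visited, so at rank `k` player 2 almost surely avoids moves that
allow a descent. While `main` is played from time `N` on, the first alternative of the certificate
thus applies in every round: the reward is 1 and the play stays in `W` at rank `k`. By
`measure_forall_main_pos` this has positive probability. -/
theorem IsPositiveCertificate.positiveWinning {W : Set S} {ρ : S → ℕ}
    (hW : G.IsPositiveCertificate W ρ main) (hs : s ∈ W) :
    G.PositiveWinning₁ (G.trembling main hmain) s (G.LimInfAvg 1) := by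
  classical
  intro σ₂
  set μ := G.playMeasure (G.trembling main hmain) σ₂ s with hμ
  have hex : ∃ k, ∃ n, μ {π | (π n).st ∈ W ∧ ρ (π n).st = k} ≠ 0 := by
    refine ⟨ρ s, 0, ?_⟩
    have : μ {π | (π 0).st ∈ W ∧ ρ (π 0).st = ρ s} = 1 := by
      refine (measure_congr (eventuallyEq_univ.2 ?_)).trans measure_univ
      filter_upwards [G.ae_state_zero (G.trembling main hmain) σ₂ s] with π hπ
      exact ⟨hπ ▸ hs, by rw [hπ]⟩
    simp [this]
  set k := Nat.find hex with hk
  obtain ⟨N, hN⟩ := Nat.find_spec hex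
  have hmin : ∀ n, ∀ᵐ π ∂μ, (π n).st ∉ {t | t ∈ W ∧ ρ t < k} := by
    intro n
    have h1 : ∀ j, ∀ᵐ π ∂μ, j < k → ¬ ((π n).st ∈ W ∧ ρ (π n).st = j) := by
      intro j
      by_cases hj : j < k
      · have h2 := Nat.find_min hex hj
        push Not at h2
        filter_upwards [measure_eq_zero_iff_ae_notMem.1 (h2 n)] with π hπ _
        exact hπ
      · exact ae_of_all _ fun π h => absurd h hj
    filter_upwards [ae_all_iff.2 h1] with π hπ hc
    exact hπ _ hc.2 ⟨hc.1, rfl⟩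
  refine (measure_forall_main_pos (hmain := hmain) (s := s) σ₂ N (fun t => t ∈ W ∧ ρ t = k)
    hN).trans_le ?_
  refine measure_mono_ae ?_
  filter_upwards [ae_all_iff.2 hmin,
    ae_all_iff.2 fun n => ae_forall_trans_notMem (hmain := hmain) (s := s) σ₂ _ n (hmin (n + 1)),
    ae_all_iff.2 (G.ae_act_mem_support (G.trembling main hmain) σ₂ s),
    ae_all_iff.2 (G.ae_state_succ_mem_support (G.trembling main hmain) σ₂ s)]
    with π h1 h2 h3 h4 hπ
  obtain ⟨h5, h6⟩ : ((π N).st ∈ W ∧ ρ (π N).st = k) ∧ ∀ n ≥ N, (π n).act₁ = main (π n).st := hπ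
  have hround : ∀ n ≥ N, (π n).st ∈ W → ρ (π n).st = k →
      G.reward (π n).st (π n).act₁ (π n).act₂ = true ∧
        (π (n + 1)).st ∈ W ∧ ρ (π (n + 1)).st = k := by
    intro n hn hnW hnk
    rcases hW _ hnW _ (σ₂.support_subset _ _ (h3 n).2) with ⟨hr, ht⟩ | ⟨a, ha, t, ht, htW, htρ⟩
    · rw [h6 n hn]
      have h7 := ht _ (h6 n hn ▸ h4 n)
      refine ⟨hr, h7.1, le_antisymm (hnk ▸ h7.2) (not_lt.1 fun hlt => h1 (n + 1) ⟨h7.1, hlt⟩)⟩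
    · exact absurd ⟨htW, hnk ▸ htρ⟩ (h2 n a ha t ht)
  have hall : ∀ n ≥ N, (π n).st ∈ W ∧ ρ (π n).st = k := by
    intro n hn
    induction n, hn using Nat.le_induction with
    | base => exact h5
    | succ n hn ih => exact (hround n hn ih.1 ih.2).2
  have hlim := G.tendsto_avgReward π (r := true) (N := N) fun n hn =>
    (hround n hn (hall n hn).1 (hall n hn).2).1
  have : liminf (G.avgReward π) atTop = 1 := by simpa using hlim.liminf_eq
  exact this.ge

end ConcurrentGame


/-! ### The dichotomy and the optimal strategies -/

namespace ConcurrentGame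

variable {S A : Type*} (G : ConcurrentGame S A)

/-- The move `b` of player 2 at `s` surely keeps the play in `Z`. -/
def IsSafeMove (Z : Set S) (s : S) (b : A) : Prop :=
  ∀ a ∈ G.moves₁ s, (G.trans s a b).support ⊆ Z

/-- From every state of `U`, player 2 can, with moves that are safe for `Z` and against each move of
player 1, either produce a reward 0 or decrease the rank within `U` with positive probability. -/
def IsAttracted (Z U : Set S) (ρ : S → ℕ) : Prop :=
  ∀ s ∈ U, ∀ a ∈ G.moves₁ s, ∃ b ∈ G.moves₂ s, G.IsSafeMove Z s b ∧
    (G.reward s a b = false ∨ ∃ t ∈ (G.trans s a b).support, t ∈ U ∧ ρ t < ρ s)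

variable {G}

theorem limInfAvg_anti {l l' : ℝ} (h : l ≤ l') : G.LimInfAvg l' ⊆ G.LimInfAvg l :=
  fun _ hπ => le_trans h hπ

theorem patience_le_of_forall [Fintype S] {σ₂ : Strategy G.moves₂}
    {B : S → Finset A} (hB : ∀ s, B s ⊆ G.moves₂ s)
    (h : ∀ x s, ∀ b ∈ (σ₂.move x s).support, σ₂.move x s b = ((B s).card : ℝ≥0∞)⁻¹) :
    σ₂.patience ≤ G.maxMoves := by
  refine iSup_le fun x => iSup_le fun s => iSup₂_le fun b hb => ?_
  rw [h x s b hb, inv_inv]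
  have h1 : (B s).card ≤ G.maxMoves :=
    (Finset.card_le_card (hB s)).trans ((le_max_right _ _).trans
      (Finset.le_sup (f := fun s => max (G.moves₁ s).card (G.moves₂ s).card) (Finset.mem_univ s)))
  exact_mod_cast h1

variable [Finite S]

theorem exists_rank_bound (ρ : S → ℕ) : ∃ K, ∀ s, ρ s ≤ K := by
  obtain ⟨K, hK⟩ := (Set.finite_range ρ).bddAbove
  exact ⟨K, fun s => hK ⟨s, rfl⟩⟩

/-- A largest attracted set is closed under one-step attraction. -/
theorem exists_isAttracted_maximal (Z : Set S) : ∃ (U : Set S) (ρ : S → ℕ),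
    U ⊆ Z ∧ G.IsAttracted Z U ρ ∧ ∀ s ∈ Z, s ∉ U → ∃ a ∈ G.moves₁ s, ∀ b ∈ G.moves₂ s,
      G.IsSafeMove Z s b →
        G.reward s a b = true ∧ ∀ t ∈ (G.trans s a b).support, t ∉ U := by
  classical
  obtain ⟨U, ⟨hUZ, ρ, hU⟩, hmax⟩ := Set.Finite.exists_maximal
    (Set.toFinite {U : Set S | U ⊆ Z ∧ ∃ ρ, G.IsAttracted Z U ρ})
    ⟨∅, Set.empty_subset _, fun _ => 0, by simp [IsAttracted]⟩
  refine ⟨U, ρ, hUZ, hU, fun s hsZ hsU => ?_⟩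
  by_contra hc
  obtain ⟨K, hK⟩ := exists_rank_bound ρ
  -- If each move of player 1 at `s` had a suitable answer, `s` could be added to `U` with a rank
  -- above all the others, against maximality.
  let ρ' : S → ℕ := fun t => if t ∈ U then ρ t else K + 1
  have hU' : G.IsAttracted Z (insert s U) ρ' := by
    have hlt : ∀ t ∈ U, ρ' t < ρ' s := fun t ht => by
      simp only [ρ', ht, hsU, if_true, if_false]
      exact Nat.lt_succ_of_le (hK t)
    intro x hx a ha
    rcases Set.mem_insert_iff.1 hx with rfl | hxU
    · by_contra hno
      refine hc ⟨a, ha, fun b hb hsafe => ⟨?_, fun t ht htU => ?_⟩⟩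
      · by_contra hr
        exact hno ⟨b, hb, hsafe, Or.inl (by simpa using hr)⟩
      · exact hno ⟨b, hb, hsafe, Or.inr ⟨t, ht, Or.inr htU, hlt t htU⟩⟩
    · obtain ⟨b, hb, hsafe, h⟩ := hU x hxU a ha
      refine ⟨b, hb, hsafe, h.imp_right ?_⟩
      rintro ⟨t, ht, htU, hlt'⟩
      refine ⟨t, ht, Or.inr htU, ?_⟩
      simpa only [ρ', htU, hxU, if_true] using hlt'
  exact hsU (hmax ⟨Set.insert_subset hsZ hUZ, ρ', hU'⟩ (Set.subset_insert s U)
    (Set.mem_insert s U))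

/-- The states split into a set on which player 1 has a positive winning certificate and a set in
which player 2 can stay while making progress towards rewards 0. -/
theorem exists_dichotomy (G : ConcurrentGame S A) : ∃ (W : Set S) (ρ₁ ρ₂ : S → ℕ) (main : S → A),
    (∀ s, main s ∈ G.moves₁ s) ∧ G.IsPositiveCertificate W ρ₁ main ∧ G.IsAttracted Wᶜ Wᶜ ρ₂ := by
  classical
  choose m₀ hm₀ using G.moves₁_nonempty
  obtain ⟨W, ⟨ρ, main, hmain, hW⟩, hmax⟩ := Set.Finite.exists_maximal
    (Set.toFinite {W : Set S | ∃ (ρ : S → ℕ) (main : S → A),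
      (∀ s, main s ∈ G.moves₁ s) ∧ G.IsPositiveCertificate W ρ main})
    ⟨∅, fun _ => 0, m₀, hm₀, by simp [IsPositiveCertificate]⟩
  obtain ⟨U, ρ₂, hUZ, hU, hout⟩ := exists_isAttracted_maximal (G := G) Wᶜ
  suffices h : U = Wᶜ from ⟨W, ρ, ρ₂, main, hmain, hW, by rwa [h] at hU⟩
  refine Set.Subset.antisymm hUZ fun s hs => ?_
  by_contra hsU
  have : Nonempty A := ⟨m₀ s⟩
  choose! m hm hm' using hout
  obtain ⟨K, hK⟩ := exists_rank_bound ρ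
  -- If `U` missed a state of `Wᶜ`, the certificate would extend from `W` to the larger set `Uᶜ`.
  -- New states rank above `W`: a move of player 2 that is unsafe for `Wᶜ` lets some move of player
  -- 1 descend into `W`, and against a safe one the move `m` gives reward 1 and avoids `U`.
  let ρ' : S → ℕ := fun t => if t ∈ W then ρ t else K + 1
  let main' : S → A := fun t => if t ∈ Wᶜ ∧ t ∉ U then m t else main t
  have hρ' : ∀ t, ρ' t ≤ K + 1 := fun t => by
    dsimp only [ρ']
    split_ifs
    · exact (hK t).trans (Nat.le_succ K)
    · exact le_rfl
  have hU' : G.IsPositiveCertificate Uᶜ ρ' main' := by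
    intro x hx b hb
    by_cases hxW : x ∈ W
    · have e1 : main' x = main x := if_neg fun h => h.1 hxW
      have e2 : ∀ t ∈ W, ρ' t = ρ t := fun t ht => if_pos ht
      rw [e1, e2 x hxW]
      refine (hW x hxW b hb).imp (fun h => ⟨h.1, fun t ht => ?_⟩) ?_
      · obtain ⟨h1, h2⟩ := h.2 t ht
        exact ⟨fun htU => hUZ htU h1, by rwa [e2 t h1]⟩
      · rintro ⟨a, ha, t, ht, htW, hlt⟩
        exact ⟨a, ha, t, ht, fun htU => hUZ htU htW, by rwa [e2 t htW]⟩
    · have e1 : main' x = m x := if_pos ⟨hxW, hx⟩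
      have e2 : ρ' x = K + 1 := if_neg hxW
      rw [e1, e2]
      by_cases hsafe : G.IsSafeMove Wᶜ x b
      · obtain ⟨h1, h2⟩ := hm' x hxW hx b hb hsafe
        exact Or.inl ⟨h1, fun t ht => ⟨h2 t ht, hρ' t⟩⟩
      · right
        simp only [IsSafeMove, Set.subset_def, not_forall, Set.mem_compl_iff, not_not] at hsafe
        obtain ⟨a, ha, t, ht, htW⟩ := hsafe
        refine ⟨a, ha, t, ht, fun htU => hUZ htU htW, ?_⟩
        simp only [ρ', htW, if_true]
        exact Nat.lt_succ_of_le (hK t)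
  have hmain' : ∀ s, main' s ∈ G.moves₁ s := fun t => by
    dsimp only [main']
    split_ifs with h
    · exact hm t h.1 h.2
    · exact hmain t
  have hWU : W ⊆ Uᶜ := fun t ht htU => hUZ htU ht
  exact hs (hmax ⟨ρ', main', hmain', hU'⟩ hWU hsU)

/-- A stationary strategy of player 2, uniform on sets of moves, that produces rewards 0 with
positive frequency almost surely from the set on which it is attracted. -/
theorem IsAttracted.exists_stationary [Fintype S] [Finite A] {Z : Set S} {ρ : S → ℕ}
    (hZ : G.IsAttracted Z Z ρ) :
    ∃ σ₂ : Strategy G.moves₂, σ₂.IsStationary ∧ σ₂.patience ≤ G.maxMoves ∧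
      ∃ L : ℕ, 0 < L ∧ ∀ (σ₁ : Strategy G.moves₁), ∀ s ∈ Z, ∀ᵐ π ∂G.playMeasure σ₁ σ₂ s,
        ∀ᶠ n in atTop, n < L * G.zeroCount (pre n π) := by
  classical
  have hB : ∀ s, ∃ B ⊆ G.moves₂ s, B.Nonempty ∧
      (s ∈ Z → ∀ b, b ∈ B ↔ b ∈ G.moves₂ s ∧ G.IsSafeMove Z s b) := by
    intro s
    by_cases hs : s ∈ Z
    · refine ⟨(G.moves₂ s).filter (G.IsSafeMove Z s), Finset.filter_subset _ _, ?_, fun _ b =>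
        Finset.mem_filter⟩
      obtain ⟨a, ha⟩ := G.moves₁_nonempty s
      obtain ⟨b, hb, hsafe, -⟩ := hZ s hs a ha
      exact ⟨b, Finset.mem_filter.2 ⟨hb, hsafe⟩⟩
    · exact ⟨G.moves₂ s, Finset.Subset.refl _, G.moves₂_nonempty s, fun h => absurd h hs⟩
  choose B hBsub hBne hBmem using hB
  let σ₂ : Strategy G.moves₂ :=
    { move := fun _ s => PMF.uniformOfFinset (B s) (hBne s)
      support_subset := fun _ s => by simpa using hBsub s }
  -- A single `p` bounds below all non-zero transition probabilities and all non-zero move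
  -- probabilities of `σ₂`; stationarity makes the empty history enough.
  obtain ⟨p, hp, hp1, hpt⟩ := Finite.exists_pos_real_le
    (Sum.elim (fun x : S × A × A × S => G.trans x.1 x.2.1 x.2.2.1 x.2.2.2)
      (fun x : S × A => σ₂.move [] x.1 x.2))
  refine ⟨σ₂, fun _ _ _ => rfl, patience_le_of_forall hBsub fun x s b hb => ?_,
    exists_zeroCount_frequency (ρ := ρ) hp hp1 (fun h s hs a ha b hb => ?_)
      fun h s hs a ha => ?_⟩
  · have hb' : b ∈ B s := by simpa [σ₂] using hb
    exact PMF.uniformOfFinset_apply_of_mem (hBne s) hb'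
  · have hb' : b ∈ B s := by simpa [σ₂] using hb
    exact ((hBmem s hs b).1 hb').2 a ha
  · obtain ⟨b, hb, hsafe, h'⟩ := hZ s hs a ha
    refine ⟨b, hpt (Sum.inr (s, b)) ?_, h'.imp_right ?_⟩
    · have : b ∈ (σ₂.move [] s).support := by
        simpa [σ₂] using (hBmem s hs b).2 ⟨hb, hsafe⟩
      exact this
    · rintro ⟨t, ht, -, hlt⟩
      exact ⟨t, hpt (Sum.inl (s, a, b, t)) ht, hlt⟩

theorem PositiveWinning₁.mono [Finite A] {σ₁ : Strategy G.moves₁} {s : S}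
    {Φ Ψ : Set (ℕ → Step S A)} (h : G.PositiveWinning₁ σ₁ s Φ) (hsub : Φ ⊆ Ψ) :
    G.PositiveWinning₁ σ₁ s Ψ := fun σ₂ => (h σ₂).trans_le (measure_mono hsub)

theorem Positive₁_mono [Finite A] {Φ Ψ : Set (ℕ → Step S A)} (hsub : Φ ⊆ Ψ) :
    G.Positive₁ Φ ⊆ G.Positive₁ Ψ := fun _ ⟨σ₁, h⟩ => ⟨σ₁, h.mono hsub⟩

/-- The value of a concurrent game for positive winning: one Markov strategy of player 1 and one
stationary strategy of player 2 are optimal, and all the objectives near 1 agree. -/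
theorem exists_optimal_strategies [Fintype S] [Finite A] (G : ConcurrentGame S A) :
    ∃ (W : Set S) (c : ℝ) (σ₁ : Strategy G.moves₁) (σ₂ : Strategy G.moves₂), 0 < c ∧
      σ₁.IsMarkov ∧ (∀ s ∈ W, G.PositiveWinning₁ σ₁ s (G.LimInfAvg 1)) ∧
      σ₂.IsStationary ∧ σ₂.patience ≤ G.maxMoves ∧
      ∀ s ∉ W, ∀ σ₁ : Strategy G.moves₁, ∀ᵐ π ∂G.playMeasure σ₁ σ₂ s,
        limsup (G.avgReward π) atTop < 1 - c := by
  obtain ⟨W, ρ₁, ρ₂, main, hmain, hW, hZ⟩ := G.exists_dichotomy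
  obtain ⟨σ₂, hst, hpat, L, hL, hfreq⟩ := hZ.exists_stationary
  have hL' : (0 : ℝ) < L := by exact_mod_cast hL
  -- The frequency bound gives `limsup ≤ 1 - 1 / L`; halving `1 / L` makes the inequality strict.
  refine ⟨W, 1 / L / 2, G.trembling main hmain, σ₂, by positivity, isMarkov_trembling,
    fun s hs => hW.positiveWinning hs, hst, hpat, fun s hs σ₁ => ?_⟩
  filter_upwards [hfreq σ₁ s hs] with π hπ
  have h1 := G.limsup_avgReward_le_of_zeroCount hL hπ
  have h2 : (0 : ℝ) < 1 / L := by positivity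
  linarith

theorem AlmostSureWinning₂.of_ae [Finite A] {σ₂ : Strategy G.moves₂} {s : S}
    {Φ : Set (ℕ → Step S A)} (h : ∀ σ₁, ∀ᵐ π ∂G.playMeasure σ₁ σ₂ s, π ∈ Φ) :
    G.AlmostSureWinning₂ σ₂ s Φ := fun σ₁ =>
  (measure_congr (eventuallyEq_univ.2 (h σ₁))).trans measure_univ

end ConcurrentGame

/-! ### Round counting and the sufficiency statements -/

/-- A Markov strategy can be played by counting rounds. -/
theorem Strategy.IsMarkov.hasTimeMemoryAtMostT {S A : Type*} {Γ : S → Finset A} {σ : Strategy Γ}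
    (hσ : σ.IsMarkov) : σ.HasTimeMemoryAtMostT := by
  classical
  -- The counter consults `σ` on a dummy history of the right length, which requires some round
  -- `x₀`. If there is none, only the empty history exists and one memory state is enough.
  rcases isEmpty_or_nonempty (Step S A) with hE | ⟨⟨x₀⟩⟩
  · let M : MemoryStrategy Γ Unit :=
      { init := ()
        next := fun s _ => σ.move [] s
        update := fun _ _ => ()
        support_subset := fun s _ => σ.support_subset [] s }
    refine ⟨Unit, M, ?_, fun T hT => ?_⟩
    · cases σ
      simp only [M, MemoryStrategy.toStrategy, Strategy.mk.injEq]
      funext h s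
      rw [Subsingleton.elim h []]
    · refine (Set.encard_le_one_iff.2 fun _ _ _ _ => rfl).trans ?_
      exact_mod_cast hT
  · let M : MemoryStrategy Γ ℕ :=
      { init := 0
        next := fun s n => σ.move (List.replicate n x₀) s
        update := fun _ n => n + 1
        support_subset := fun s n => σ.support_subset _ s }
    have hmem : ∀ h, M.memoryAfter h = h.length := by
      have aux : ∀ (h : List (Step S A)) (n : ℕ),
          h.foldl (fun m x => M.update x m) n = n + h.length := by
        intro h
        induction h with
        | nil => simp
        | cons x h ih =>
          intro n
          rw [List.foldl_cons, ih]
          simp only [M, List.length_cons]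
          omega
      intro h
      exact (aux h 0).trans (zero_add _)
    refine ⟨ℕ, M, ?_, fun T _ => ?_⟩
    · have h1 : M.toStrategy.move = σ.move := by
        funext h s
        change σ.move (List.replicate (M.memoryAfter h) x₀) s = σ.move h s
        exact hσ _ _ (by rw [hmem, List.length_replicate]) s
      cases σ
      simp only [MemoryStrategy.toStrategy] at h1 ⊢
      simp only [Strategy.mk.injEq]
      exact h1
    · have hsub : {m : ℕ | ∃ h : List (Step S A), h.length < T ∧ M.memoryAfter h = m} ⊆
          (Finset.range T : Set ℕ) := by
        rintro m ⟨h, hh, rfl⟩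
        rw [hmem]
        simpa using hh
      refine (Set.encard_le_encard hsub).trans ?_
      rw [Set.encard_coe_eq_coe_finsetCard, Finset.card_range]

-- Off `W`, the strategy `σ₂` forces a limsup below `1 - c`, so every positive winning set for a
-- threshold at least `1 - c` lies in `W`. On `W`, the strategy `σ₁` wins for `LimInfAvg 1`, hence
-- for every weaker objective. So `ε₀ = c` works.
open ConcurrentGame in
theorem player_one_sufficiency {S A : Type*} [Fintype S] [Fintype A] (G : ConcurrentGame S A) :
    ∃ σ₁ : Strategy G.moves₁, σ₁.IsMarkov ∧ σ₁.HasTimeMemoryAtMostT ∧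
      (∀ s ∈ G.Positive₁ (G.LimInfAvg 1), G.PositiveWinning₁ σ₁ s (G.LimInfAvg 1)) ∧
      (∀ s ∈ G.Positive₁ (G.LimSupAvg 1), G.PositiveWinning₁ σ₁ s (G.LimSupAvg 1)) ∧
      (∀ s ∈ ⋂ ε > (0 : ℝ), G.Positive₁ (G.LimInfAvg (1 - ε)),
        ∀ ε > (0 : ℝ), G.PositiveWinning₁ σ₁ s (G.LimInfAvg (1 - ε))) ∧
      (∀ s ∈ ⋂ ε > (0 : ℝ), G.Positive₁ (G.LimSupAvg (1 - ε)),
        ∀ ε > (0 : ℝ), G.PositiveWinning₁ σ₁ s (G.LimSupAvg (1 - ε))) ∧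
      ∃ ε₀ > (0 : ℝ), ∀ ε : ℝ, 0 < ε → ε < ε₀ →
        (∀ s ∈ G.Positive₁ (G.LimInfAvg (1 - ε)),
          G.PositiveWinning₁ σ₁ s (G.LimInfAvg (1 - ε))) ∧
        (∀ s ∈ G.Positive₁ (G.LimSupAvg (1 - ε)),
          G.PositiveWinning₁ σ₁ s (G.LimSupAvg (1 - ε))) := by
  obtain ⟨W, c, σ₁, σ₂, hc, hM, hW, -, -, hZ⟩ := G.exists_optimal_strategies
  have hsup : ∀ l, 1 - c ≤ l → G.Positive₁ (G.LimSupAvg l) ⊆ W := by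
    rintro l hl s ⟨τ, hτ⟩
    by_contra hs
    refine (hτ σ₂).ne' (measure_eq_zero_iff_ae_notMem.2 ?_)
    filter_upwards [hZ s hs τ] with π hπ hmem
    exact absurd (hl.trans hmem) (not_le.2 hπ)
  have hinf : ∀ l, 1 - c ≤ l → G.Positive₁ (G.LimInfAvg l) ⊆ W := fun l hl =>
    (Positive₁_mono (G.limInfAvg_subset_limSupAvg l)).trans (hsup l hl)
  have winf : ∀ s ∈ W, ∀ l ≤ 1, G.PositiveWinning₁ σ₁ s (G.LimInfAvg l) := fun s hs l hl =>
    (hW s hs).mono (limInfAvg_anti hl)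
  have wsup : ∀ s ∈ W, ∀ l ≤ 1, G.PositiveWinning₁ σ₁ s (G.LimSupAvg l) := fun s hs l hl =>
    (winf s hs l hl).mono (G.limInfAvg_subset_limSupAvg l)
  refine ⟨σ₁, hM, hM.hasTimeMemoryAtMostT, ?_, ?_, ?_, ?_, c, hc, fun ε h0 hε => ⟨?_, ?_⟩⟩
  · exact fun s hs => winf s (hinf 1 (by linarith) hs) 1 le_rfl
  · exact fun s hs => wsup s (hsup 1 (by linarith) hs) 1 le_rfl
  · intro s hs ε hε
    simp only [Set.mem_iInter] at hs
    exact winf s (hinf _ le_rfl (hs c hc)) _ (by linarith)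
  · intro s hs ε hε
    simp only [Set.mem_iInter] at hs
    exact wsup s (hsup _ le_rfl (hs c hc)) _ (by linarith)
  · exact fun s hs => winf s (hinf _ (by linarith) hs) _ (by linarith)
  · exact fun s hs => wsup s (hsup _ (by linarith) hs) _ (by linarith)

open ConcurrentGame in
theorem player_two_sufficiency {S A : Type*} [Fintype S] [Fintype A] (G : ConcurrentGame S A) :
    ∃ c > (0 : ℝ), ∃ σ₂ : Strategy G.moves₂, σ₂.IsStationary ∧ σ₂.patience ≤ G.maxMoves ∧
      ∀ s ∉ G.Positive₁ (G.LimInfAvg 1),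
        G.AlmostSureWinning₂ σ₂ s (G.CoLimInfAvg 1) ∧
        G.AlmostSureWinning₂ σ₂ s (G.CoLimInfAvg (1 - c)) ∧
        G.AlmostSureWinning₂ σ₂ s (G.CoLimSupAvg 1) ∧
        G.AlmostSureWinning₂ σ₂ s (G.CoLimSupAvg (1 - c)) := by
  obtain ⟨W, c, σ₁, σ₂, hc, -, hW, hst, hpat, hZ⟩ := G.exists_optimal_strategies
  refine ⟨c, hc, σ₂, hst, hpat, fun s hs => ?_⟩
  have hsW : s ∉ W := fun h => hs ⟨σ₁, hW s h⟩
  have h1 : 1 - c ≤ (1 : ℝ) := by linarith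
  refine ⟨.of_ae fun τ => ?_, .of_ae fun τ => ?_, .of_ae fun τ => ?_, .of_ae fun τ => ?_⟩ <;>
    filter_upwards [hZ s hsW τ] with π hπ
  · exact ((G.liminf_avgReward_le_limsup π).trans_lt hπ).trans_le h1
  · exact (G.liminf_avgReward_le_limsup π).trans_lt hπ
  · exact lt_of_lt_of_le hπ h1
  · exact hπ


open ConcurrentGame

/-! ### Infinite memory is necessary for player 1 -/

namespace BarGame

/-- The history of `n` rounds in which `a₂` and `b₂` are always played. -/
def loop (n : ℕ) : List (Step BarState BarMove) := List.replicate n ⟨.v, .a2, .b2⟩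

theorem loop_succ (n : ℕ) : loop (n + 1) = loop n ++ [⟨.v, .a2, .b2⟩] :=
  List.replicate_succ'

@[simp]
theorem length_loop (n : ℕ) : (loop n).length = n := List.length_replicate

/-- The main move `a2` at `v` is good against `b2`; against `b1`, the move `a1` reaches `v1`, which
has lower rank. -/
theorem mem_positive₁ : BarState.v ∈ barG.Positive₁ (barG.LimInfAvg 1) := by
  let main : BarState → BarMove
    | .v0 => .aAbs0
    | .v1 => .aAbs1
    | .v => .a2
  let ρ : BarState → ℕ
    | .v => 1
    | _ => 0
  have hmain : ∀ s, main s ∈ barG.moves₁ s := fun s => by cases s <;> simp [main, barG]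
  have hW : barG.IsPositiveCertificate {s | s ≠ .v0} ρ main := by
    intro s hs b hb
    cases s
    · exact absurd rfl hs
    · left
      simp [barG]
    · have hb' : b = .b1 ∨ b = .b2 := by simpa [barG] using hb
      rcases hb' with rfl | rfl
      · right
        exact ⟨.a1, by simp [barG], .v1, by simp [barG], by simp, by simp [ρ]⟩
      · left
        simp [barG, main]
  exact ⟨barG.trembling main hmain, hW.positiveWinning (by simp)⟩

/-- The reply of player 2 that punishes `a₂` by `b₁` when `a₁` has probability 0, and otherwise
waits for `a₁` with `b₂`. -/
def reply (σ₁ : Strategy barG.moves₁) : Strategy barG.moves₂ where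
  move h
    | .v0 => PMF.pure .bAbs0
    | .v1 => PMF.pure .bAbs1
    | .v => if σ₁.move (loop h.length) .v .a1 = 0 then PMF.pure .b1 else PMF.pure .b2
  support_subset h s := by
    cases s
    · simp [barG]
    · simp [barG]
    · dsimp only
      split_ifs <;> simp [barG]

/-- The reply never lets `a1` meet `b1`, so `v1` is not reached and remaining at `v` means having
looped. In particular it is harmless that `reply` consults `σ₁` only on loop histories. The last
clause feeds the decay estimate: staying at `v` requires that `a1` was possible but not drawn. -/
theorem ae_loop_or_v0 (σ₁ : Strategy barG.moves₁) :
    ∀ᵐ π ∂barG.playMeasure σ₁ (reply σ₁) .v, ∀ n,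
      (((π n).st = .v ∧ pre n π = loop n) ∨ (π n).st = .v0) ∧
      ((π n).st = .v0 → (π (n + 1)).st = .v0) ∧
      ((π (n + 1)).st = .v → (π n).st = .v ∧ pre n π = loop n ∧ (π n).act₁ ≠ .a1 ∧
        σ₁.move (loop n) .v .a1 ≠ 0) := by
  filter_upwards [barG.ae_state_zero σ₁ (reply σ₁) .v,
    ae_all_iff.2 (barG.ae_act_mem_support σ₁ (reply σ₁) .v),
    ae_all_iff.2 (barG.ae_state_succ_mem_support σ₁ (reply σ₁) .v)] with π h0 h1 h2
  have habs : ∀ n, (π n).st = .v0 → (π (n + 1)).st = .v0 := fun n hn => by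
    have := h2 n
    rw [hn] at this
    simpa [barG] using this
  have hv : ∀ n, (π n).st = .v → pre n π = loop n →
      (π (n + 1)).st = .v0 ∨ ((π (n + 1)).st = .v ∧ pre (n + 1) π = loop (n + 1) ∧
        (π n).act₁ ≠ .a1 ∧ σ₁.move (loop n) .v .a1 ≠ 0) := by
    intro n hn hpre
    obtain ⟨h3, h4⟩ := h1 n
    have h5 := h2 n
    have h6 : (π n).act₁ = .a1 ∨ (π n).act₁ = .a2 := by
      have := σ₁.support_subset _ _ h3
      rw [hn] at this
      simpa [barG] using this
    rw [hn, hpre] at h3 h4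
    rw [hn] at h5
    simp only [reply, length_loop] at h4
    split_ifs at h4 with hx
    · have hb : (π n).act₂ = .b1 := by simpa using h4
      rcases h6 with ha | ha
      · rw [ha] at h3
        exact absurd hx h3
      · left
        rw [ha, hb] at h5
        simpa [barG] using h5
    · have hb : (π n).act₂ = .b2 := by simpa using h4
      rcases h6 with ha | ha
      · left
        rw [ha, hb] at h5
        simpa [barG] using h5
      · right
        have hstep : π n = ⟨.v, .a2, .b2⟩ := by
          cases hπ : π n
          simp_all
        rw [ha, hb] at h5
        refine ⟨by simpa [barG] using h5, ?_, by simp [ha], hx⟩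
        rw [pre_succ, loop_succ, hpre, hstep]
  have hinv : ∀ n, ((π n).st = .v ∧ pre n π = loop n) ∨ (π n).st = .v0 := by
    intro n
    induction n with
    | zero => exact Or.inl ⟨h0, rfl⟩
    | succ n ih =>
      rcases ih with ⟨hn, hpre⟩ | hn
      · rcases hv n hn hpre with h | h
        · exact Or.inr h
        · exact Or.inl ⟨h.1, h.2.1⟩
      · exact Or.inr (habs n hn)
  refine fun n => ⟨hinv n, habs n, fun hn1 => ?_⟩
  rcases hinv n with ⟨hn, hpre⟩ | hn
  · rcases hv n hn hpre with h | h
    · rw [hn1] at h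
      cases h
    · exact ⟨hn, hpre, h.2.2⟩
  · have := habs n hn
    rw [hn1] at this
    cases this

/-- If the probabilities of `a₁` along the loop are zero or bounded below, the reply of player 2
forces the average reward 0 almost surely. -/
theorem ae_tendsto_avgReward_zero (σ₁ : Strategy barG.moves₁) {p : ℝ} (hp : 0 < p)
    (hx : ∀ n, σ₁.move (loop n) .v .a1 ≠ 0 → ENNReal.ofReal p ≤ σ₁.move (loop n) .v .a1) :
    ∀ᵐ π ∂barG.playMeasure σ₁ (reply σ₁) .v, Tendsto (barG.avgReward π) atTop (nhds 0) := by
  classical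
  set μ := barG.playMeasure σ₁ (reply σ₁) .v with hμ
  have hstep : ∀ n, μ {π | (π (n + 1)).st = .v} ≤
      ENNReal.ofReal (1 - p * (1 - 0)) * μ {π | (π n).st = .v} := by
    intro n
    -- `F` dominates the indicator of being at `v` one round later. Its mean over the moves is at
    -- most `1 - p`, and it is 0 where `a1` has probability 0, since `b1` then ends the loop.
    let F : List (Step BarState BarMove) → Step BarState BarMove → ℝ≥0∞ := fun h y =>
      if y.st = .v ∧ h = loop n ∧ σ₁.move (loop n) .v .a1 ≠ 0 then
        (if y.act₁ = .a1 then 0 else 1) else 0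
    have hm : ∀ k, MeasurableSet {π : ℕ → Step BarState BarMove | (π k).st = .v} := fun k =>
      measurableSet_setOfPred.2 (measurable_pre_eval k fun _ y => y.st = BarState.v)
    rw [← lintegral_indicator_one (hm _), ← lintegral_indicator_one (hm _),
      ← lintegral_const_mul _ (measurable_one.indicator (hm n))]
    have h1 : ∫⁻ π, {π : ℕ → Step BarState BarMove | (π (n + 1)).st = .v}.indicator 1 π ∂μ ≤
        ∫⁻ π, F (pre n π) (π n) ∂μ := by
      refine lintegral_mono_ae ?_
      filter_upwards [ae_loop_or_v0 σ₁] with π hπ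
      by_cases h : (π (n + 1)).st = .v
      · obtain ⟨h2, h3, h4, h5⟩ := (hπ n).2.2 h
        simp [F, h, h2, h3, h4, h5]
      · simp [h]
    refine h1.trans ?_
    rw [hμ, lintegral_round _ _ _ _ n F]
    refine lintegral_mono fun π => ?_
    by_cases h : (π n).st = .v ∧ pre n π = loop n ∧ σ₁.move (loop n) .v .a1 ≠ 0
    · have e : ∀ a b, F (pre n π) ⟨(π n).st, a, b⟩ = if a = .a1 then 0 else 1 := fun a b => if_pos h
      simp only [e, PMF.mean_const]
      rw [Set.indicator_of_mem (show π ∈ {π : ℕ → Step BarState BarMove | (π n).st = .v} from h.1),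
        Pi.one_apply, mul_one]
      refine PMF.mean_le_ofReal _ (a := BarMove.a1) (fun a _ => ?_) le_rfl zero_le_one hp.le ?_ ?_
      · split_ifs <;> simp
      · simp
      · rw [h.1, h.2.1]
        exact hx n h.2.2
    · have e : ∀ a b, F (pre n π) ⟨(π n).st, a, b⟩ = 0 := fun a b => if_neg h
      simp only [e, PMF.mean_const]
      exact zero_le
  have hpow : ∀ n, μ {π | (π n).st = .v} ≤ ENNReal.ofReal (1 - p * (1 - 0)) ^ n := by
    intro n
    induction n with
    | zero => simpa using prob_le_one
    | succ n ih =>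
      rw [pow_succ']
      exact (hstep n).trans (mul_le_mul_right ih _)
  have hr : ENNReal.ofReal (1 - p * (1 - 0)) < 1 := by
    rw [← ENNReal.ofReal_one]
    exact (ENNReal.ofReal_lt_ofReal_iff one_pos).2 (by linarith)
  have h0 : μ {π | ∀ n, (π n).st = .v} = 0 := by
    refine le_antisymm (ge_of_tendsto' (ENNReal.tendsto_pow_atTop_nhds_zero_of_lt_one hr)
      fun n => (measure_mono fun π hπ => ?_).trans (hpow n)) zero_le
    exact hπ n
  filter_upwards [measure_eq_zero_iff_ae_notMem.1 h0, ae_loop_or_v0 σ₁] with π h1 h2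
  obtain ⟨N, hN⟩ := not_forall.1 h1
  have hN0 : (π N).st = .v0 := ((h2 N).1.resolve_left fun h => hN h.1)
  have hall : ∀ n ≥ N, (π n).st = .v0 := by
    intro n hn
    induction n, hn using Nat.le_induction with
    | base => exact hN0
    | succ n _ ih => exact (h2 n).2.1 ih
  simpa using barG.tendsto_avgReward π (r := false) (N := N) fun n hn => by
    rw [hall n hn]
    rfl

/-- Updates are deterministic, so a repetition makes the memory along the loop eventually periodic.
The probabilities of `a1` then take finitely many values, the non-zero ones are bounded below, and
`reply` forces average 0 almost surely. -/
theorem memoryAfter_loop_injective {Mem : Type*} {M : MemoryStrategy barG.moves₁ Mem} {l : ℝ}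
    (hl : 0 < l) (hwin : barG.PositiveWinning₁ M.toStrategy .v (barG.LimInfAvg l) ∨
      barG.PositiveWinning₁ M.toStrategy .v (barG.LimSupAvg l)) :
    Function.Injective fun n => M.memoryAfter (loop n) := by
  have hsucc : ∀ n, M.memoryAfter (loop (n + 1)) =
      M.update ⟨.v, .a2, .b2⟩ (M.memoryAfter (loop n)) := fun n => by
    simp [MemoryStrategy.memoryAfter, loop_succ]
  refine .of_lt_imp_ne fun i j hij heq => ?_
  have hper : ∀ n, ∃ k : Fin j, M.memoryAfter (loop n) = M.memoryAfter (loop k) := by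
    intro n
    induction n with
    | zero => exact ⟨⟨0, by omega⟩, rfl⟩
    | succ n ih =>
      obtain ⟨k, hk⟩ := ih
      have h1 : M.memoryAfter (loop (n + 1)) = M.memoryAfter (loop (k + 1)) := by
        rw [hsucc, hsucc, hk]
      rcases Nat.lt_or_ge (k + 1) j with h | h
      · exact ⟨⟨k + 1, h⟩, h1⟩
      · have h2 : (k : ℕ) + 1 = j := le_antisymm k.2 h
        exact ⟨⟨i, hij⟩, by rw [h1, h2]; exact heq.symm⟩
  obtain ⟨p, hp, -, hpk⟩ := Finite.exists_pos_real_le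
    fun k : Fin j => M.toStrategy.move (loop k) .v .a1
  have hae := ae_tendsto_avgReward_zero M.toStrategy hp fun n hn => by
    obtain ⟨k, hk⟩ := hper n
    have h1 : M.toStrategy.move (loop n) .v = M.toStrategy.move (loop k) .v := by
      simp only [MemoryStrategy.toStrategy, hk]
    rw [h1] at hn ⊢
    exact hpk k hn
  rcases hwin with h | h <;>
  · refine (h (reply M.toStrategy)).ne' (measure_eq_zero_iff_ae_notMem.2 ?_)
    filter_upwards [hae] with π hπ hmem
    first
    | exact absurd (hπ.liminf_eq ▸ hmem : l ≤ (0 : ℝ)) (not_le.2 hl)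
    | exact absurd (hπ.limsup_eq ▸ hmem : l ≤ (0 : ℝ)) (not_le.2 hl)

theorem player_one_necessity {ε : ℝ} (hε : ε < 1) (σ₁ : Strategy barG.moves₁)
    (hwin : barG.PositiveWinning₁ σ₁ BarState.v (barG.LimInfAvg (1 - ε)) ∨
      barG.PositiveWinning₁ σ₁ BarState.v (barG.LimSupAvg (1 - ε))) :
    ¬ σ₁.IsFiniteMemory ∧
      ∀ (Mem : Type*) (M : MemoryStrategy barG.moves₁ Mem), M.toStrategy = σ₁ →
        ∀ T : ℕ, 0 < T → (T : ℕ∞) ≤ M.timeMemory T := by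
  constructor
  · rintro ⟨Mem, _, M, rfl⟩
    exact not_injective_infinite_finite _ (memoryAfter_loop_injective (by linarith) hwin)
  · rintro Mem M rfl T -
    have hinj := memoryAfter_loop_injective (by linarith) hwin
    have hsub : (fun n => M.memoryAfter (loop n)) '' (Finset.range T : Set ℕ) ⊆
        {m : Mem | ∃ h : List (Step BarState BarMove), h.length < T ∧ M.memoryAfter h = m} := by
      rintro _ ⟨n, hn, rfl⟩
      exact ⟨loop n, by simpa using hn, rfl⟩
    refine le_trans (le_of_eq ?_) (Set.encard_le_encard hsub)
    rw [hinj.encard_image, Set.encard_coe_eq_coe_finsetCard, Finset.card_range]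

end BarGame

/-! ### Patience `m` is necessary for player 2 -/

namespace UnderGame

variable {m : ℕ} {hm : 0 < m}

theorem maxMoves_eq : (underG m hm).maxMoves = m := by
  simp [maxMoves, underG]

theorem mem_almost₂ : () ∈ (underG m hm).Almost₂ ((underG m hm).CoLimInfAvg 1) := by
  have hZ : (underG m hm).IsAttracted Set.univ Set.univ fun _ => 0 := by
    intro s _ a ha
    obtain ⟨i, rfl⟩ : ∃ i, Sum.inl i = a := by simpa [underG] using ha
    exact ⟨Sum.inr i, by simp [underG], fun _ _ => Set.subset_univ _, Or.inl (by simp [underG])⟩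
  obtain ⟨σ₂, -, -, L, hL, h⟩ := hZ.exists_stationary
  refine ⟨σ₂, .of_ae fun σ₁ => ?_⟩
  filter_upwards [h σ₁ () trivial] with π hπ
  have h1 := (underG m hm).limsup_avgReward_le_of_zeroCount hL hπ
  have h2 : (0 : ℝ) < 1 / L := by positivity
  have h3 := (underG m hm).liminf_avgReward_le_limsup π
  change liminf _ _ < (1 : ℝ)
  linarith

/-- Otherwise all `m` moves have probability at least the inverse patience, which exceeds `1 / m`,
and the total exceeds 1. -/
theorem exists_unplayed {σ₂ : Strategy (underG m hm).moves₂} (h : σ₂.patience < m) :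
    ∃ j : Fin m, σ₂.move [] () (Sum.inr j) = 0 := by
  by_contra! hc
  have h1 : ∀ j : Fin m, σ₂.patience⁻¹ ≤ σ₂.move [] () (Sum.inr j) := fun j => by
    rw [ENNReal.inv_le_iff_inv_le]
    exact le_iSup_of_le [] (le_iSup_of_le () (le_iSup₂_of_le (Sum.inr j) (hc j) le_rfl))
  have h2 : (m : ℝ≥0∞) * σ₂.patience⁻¹ ≤ 1 := by
    calc (m : ℝ≥0∞) * σ₂.patience⁻¹ = ∑ _j : Fin m, σ₂.patience⁻¹ := by simp
      _ ≤ ∑ j : Fin m, σ₂.move [] () (Sum.inr j) := Finset.sum_le_sum fun j _ => h1 j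
      _ ≤ ∑ x : Fin m ⊕ Fin m, σ₂.move [] () x := by
        rw [Fintype.sum_sum_type]
        exact le_add_self
      _ = 1 := by rw [← tsum_fintype (L := .unconditional _), PMF.tsum_coe]
  have hm0 : (m : ℝ≥0∞) ≠ 0 := by exact_mod_cast hm.ne'
  have h3 : (m : ℝ≥0∞) * (m : ℝ≥0∞)⁻¹ < m * σ₂.patience⁻¹ :=
    ENNReal.mul_lt_mul_right hm0 (ENNReal.natCast_ne_top m) (ENNReal.inv_lt_inv.2 h)
  rw [ENNReal.mul_inv_cancel hm0 (ENNReal.natCast_ne_top m)] at h3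
  exact absurd h2 (not_le.2 h3)

theorem exists_ae_tendsto_one {σ₂ : Strategy (underG m hm).moves₂} (hst : σ₂.IsStationary)
    (h : σ₂.patience < m) : ∃ σ₁ : Strategy (underG m hm).moves₁,
      ∀ᵐ π ∂(underG m hm).playMeasure σ₁ σ₂ (),
        Tendsto ((underG m hm).avgReward π) atTop (nhds 1) := by
  obtain ⟨j, hj⟩ := exists_unplayed h
  let σ₁ : Strategy (underG m hm).moves₁ :=
    { move := fun _ _ => PMF.pure (Sum.inl j)
      support_subset := fun _ _ => by simp [underG] }
  refine ⟨σ₁, ?_⟩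
  filter_upwards [ae_all_iff.2 ((underG m hm).ae_act_mem_support σ₁ σ₂ ())] with π hπ
  have := (underG m hm).tendsto_avgReward π (r := true) (N := 0) fun n _ => by
    obtain ⟨h1, h2⟩ := hπ n
    have h3 : (π n).act₁ = Sum.inl j := by simpa [σ₁] using h1
    obtain ⟨i, hi⟩ : ∃ i, Sum.inr i = (π n).act₂ := by
      simpa [underG] using σ₂.support_subset _ _ h2
    have hij : j ≠ i := by
      rintro rfl
      -- The unplayed index was found at the empty history; stationarity carries it to every round.
      rw [hst _ [] _, ← hi] at h2
      exact h2 hj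
    rw [h3, ← hi]
    simpa [underG] using hij
  simpa using this

theorem player_two_necessity {σ₂ : Strategy (underG m hm).moves₂} (hst : σ₂.IsStationary)
    (h : σ₂.patience < m) {c : ℝ} (hc : 0 ≤ c) :
    ¬ (underG m hm).AlmostSureWinning₂ σ₂ () ((underG m hm).CoLimInfAvg (1 - c)) ∧
      ¬ (underG m hm).AlmostSureWinning₂ σ₂ () ((underG m hm).CoLimSupAvg (1 - c)) := by
  obtain ⟨σ₁, hae⟩ := exists_ae_tendsto_one hst h
  have hc' : 1 - c ≤ (1 : ℝ) := by linarith
  constructor <;> intro hw <;>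
    refine zero_ne_one (((measure_eq_zero_iff_ae_notMem.2 ?_).symm).trans (hw σ₁)) <;>
    filter_upwards [hae] with π hπ hmem
  · exact absurd (hπ.liminf_eq ▸ hmem : (1 : ℝ) < 1 - c) (not_lt.2 hc')
  · exact absurd (hπ.limsup_eq ▸ hmem : (1 : ℝ) < 1 - c) (not_lt.2 hc')

end UnderGame

end

theorem mainTheorem5 :
    -- Player 1: a Markov strategy with time-dependent memory `T` suffices in every game.
    (∀ (S A : Type*) [Fintype S] [Fintype A] (G : ConcurrentGame S A),
      ∃ σ₁ : Strategy G.moves₁, σ₁.IsMarkov ∧ σ₁.HasTimeMemoryAtMostT ∧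
        -- exact qualitative constraints
        (∀ s ∈ G.Positive₁ (G.LimInfAvg 1), G.PositiveWinning₁ σ₁ s (G.LimInfAvg 1)) ∧
        (∀ s ∈ G.Positive₁ (G.LimSupAvg 1), G.PositiveWinning₁ σ₁ s (G.LimSupAvg 1)) ∧
        -- limit qualitative constraints
        (∀ s ∈ ⋂ ε > (0 : ℝ), G.Positive₁ (G.LimInfAvg (1 - ε)),
          ∀ ε > (0 : ℝ), G.PositiveWinning₁ σ₁ s (G.LimInfAvg (1 - ε))) ∧
        (∀ s ∈ ⋂ ε > (0 : ℝ), G.Positive₁ (G.LimSupAvg (1 - ε)),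
          ∀ ε > (0 : ℝ), G.PositiveWinning₁ σ₁ s (G.LimSupAvg (1 - ε))) ∧
        -- for all small `ε` the hypothesis is only needed for this `ε`
        ∃ ε₀ > (0 : ℝ), ∀ ε : ℝ, 0 < ε → ε < ε₀ →
          (∀ s ∈ G.Positive₁ (G.LimInfAvg (1 - ε)),
            G.PositiveWinning₁ σ₁ s (G.LimInfAvg (1 - ε))) ∧
          (∀ s ∈ G.Positive₁ (G.LimSupAvg (1 - ε)),
            G.PositiveWinning₁ σ₁ s (G.LimSupAvg (1 - ε)))) ∧
    -- Player 1: infinite memory and time-dependent memory `T` are needed in `barG`.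
    (BarState.v ∈ barG.Positive₁ (barG.LimInfAvg 1) ∧
      ∀ ε : ℝ, 0 ≤ ε → ε < 1 → ∀ σ₁ : Strategy barG.moves₁,
        (barG.PositiveWinning₁ σ₁ BarState.v (barG.LimInfAvg (1 - ε)) ∨
          barG.PositiveWinning₁ σ₁ BarState.v (barG.LimSupAvg (1 - ε))) →
        ¬ σ₁.IsFiniteMemory ∧
        ∀ (Mem : Type*) (M : MemoryStrategy barG.moves₁ Mem), M.toStrategy = σ₁ →
          ∀ T : ℕ, 0 < T → (T : ℕ∞) ≤ M.timeMemory T) ∧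
    -- Player 2: stationary strategies with patience at most `m` suffice in every game.
    (∀ (S A : Type*) [Fintype S] [Fintype A] (G : ConcurrentGame S A),
      ∃ c > (0 : ℝ), ∃ σ₂ : Strategy G.moves₂, σ₂.IsStationary ∧ σ₂.patience ≤ G.maxMoves ∧
        ∀ s ∉ G.Positive₁ (G.LimInfAvg 1),
          G.AlmostSureWinning₂ σ₂ s (G.CoLimInfAvg 1) ∧
          G.AlmostSureWinning₂ σ₂ s (G.CoLimInfAvg (1 - c)) ∧
          G.AlmostSureWinning₂ σ₂ s (G.CoLimSupAvg 1) ∧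
          G.AlmostSureWinning₂ σ₂ s (G.CoLimSupAvg (1 - c))) ∧
    -- Player 2: patience `m` is needed in `underG m`.
    (∀ (m : ℕ) (hm : 0 < m),
      (underG m hm).maxMoves = m ∧
      () ∈ (underG m hm).Almost₂ ((underG m hm).CoLimInfAvg 1) ∧
      ∀ σ₂ : Strategy (underG m hm).moves₂, σ₂.IsStationary → σ₂.patience < m →
        ∀ c : ℝ, 0 ≤ c →
          ¬ (underG m hm).AlmostSureWinning₂ σ₂ () ((underG m hm).CoLimInfAvg (1 - c)) ∧
          ¬ (underG m hm).AlmostSureWinning₂ σ₂ () ((underG m hm).CoLimSupAvg (1 - c))) := by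
  refine ⟨fun S A _ _ G => player_one_sufficiency G, ⟨BarGame.mem_positive₁, ?_⟩,
    fun S A _ _ G => player_two_sufficiency G, fun m hm => ⟨UnderGame.maxMoves_eq,
      UnderGame.mem_almost₂, fun σ₂ hst h c hc => UnderGame.player_two_necessity hst h hc⟩⟩
  exact fun ε _ hε σ₁ hwin => BarGame.player_one_necessity hε σ₁ hwin
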